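/- Let $1\le p<\infty$, $r>1$, and let $h\in C([0,1])$ be real-valued. Let $\varphi:[0,\infty)\times(0,1)\to(0,1)$ be the semiflow of $F(x)=-x^r$ on $(0,1)$, i.e. $t\mapsto\varphi(t,x_0)$ is the solution of $\dot x=F(x)$, $x(0)=x_0$. For $t\ge 0$ and a function $f$ on $(0,1)$ put $$(T_{r,h}(t)f)(x)=\exp\Big(\int_0^t h(\varphi(s,x))\,ds\Big)\,f(\varphi(t,x)),\qquad x\in(0,1).$$ Let $\mathcal T_{r,h}=(T_{r,h}(t))_{t\ge0}$ be the resulting $C_0$-semigroup on $L^p(0,1)$ (generalized von Foerster–Lasota semigroup), and let $\mathcal S_{r,h}$ be its restriction to $W^{1,p}(0,1)$, with norm $\|u\|_{1,p}=\|u\|_p+\|u'\|_p$; let $W^{1,p}_*(0,1)$ be the subspace of those $u\in W^{1,p}(0,1)$ whose continuous representative on $[0,1]$ vanishes at $0$. A semigroup $(T(t))_{t\ge0}$ is called stable on a normed space $X$ if $\lim_{t\to\infty}\|T(t)f\|_X=0$ for every $f\in X$. (a) Assume that $x\mapsto \dfrac{h(x)-x^{r-1}h(0)}{x^r}$ belongs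 to $L^1(0,1)$. Then $\mathcal T_{r,h}$ is stable on $L^p(0,1)$ if and only if $h(0)\le -\dfrac rp$. (b) Assume that $h\in W^{1,\infty}(0,1)$ and that $x\mapsto\dfrac{h(x)-h(0)}{x^r}$ belongs to $L^\infty(0,1)$. Then $\mathcal S_{r,h}$ is stable on $W^{1,p}_*(0,1)$ if and only if $h(0)\le 0$, and $\mathcal S_{r,h}$ is stable on $W^{1,p}(0,1)$ if and only if $h(0)<0$. -/

import Mathlib

open MeasureTheory Set Filter Topology
open scoped ENNReal ContDiff

noncomputable section

/-- `γ`, restricted to `[0, ∞)`, is a global forward solution in `Ω` of the initial value problem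
`x' = F x`, `x 0 = x₀`. -/
structure IsForwardSolution (F : ℝ → ℝ) (Ω : Set ℝ) (x₀ : ℝ) (γ : ℝ → ℝ) : Prop where
  initial : γ 0 = x₀
  mem : ∀ t, 0 ≤ t → γ t ∈ Ω
  hasDeriv : ∀ t, 0 ≤ t → HasDerivWithinAt γ (F (γ t)) (Ici 0) t

open Classical in
/-- The semiflow `φ(t, x₀)`, `t ≥ 0`, `x₀ ∈ Ω`, of the vector field `F` on `Ω`: the value at time
`t` of the solution of `x' = F x`, `x 0 = x₀` (and `x₀` if there is no global forward solution,
for instance if `x₀ ∉ Ω`). -/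
def semiflow (F : ℝ → ℝ) (Ω : Set ℝ) (t x₀ : ℝ) : ℝ :=
  if hγ : ∃ γ, IsForwardSolution F Ω x₀ γ then hγ.choose t else x₀

/-- The weighted composition semigroup
`(T_{F,h}(t) f)(x) = exp (∫₀ᵗ h(φ(s, x)) ds) f(φ(t, x))`, with `φ` the semiflow of `F` on `Ω`. -/
def weightedCompSemigroup (F h : ℝ → ℝ) (Ω : Set ℝ) (t : ℝ) (f : ℝ → ℝ) : ℝ → ℝ := fun x =>
  Real.exp (∫ s in (0 : ℝ)..t, h (semiflow F Ω s x)) * f (semiflow F Ω t x)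

/-- The generalized von Foerster-Lasota semigroup: `F x = -x ^ r` on `(0, 1)`. -/
def vonFoersterLasota (r : ℝ) (h : ℝ → ℝ) : ℝ → (ℝ → ℝ) → (ℝ → ℝ) :=
  weightedCompSemigroup (fun x => -x ^ r) h (Ioo 0 1)

/-- Lebesgue measure on the interval `(a, b)`. -/
abbrev volIoo (a b : ℝ) : Measure ℝ := volume.restrict (Ioo a b)

/-- `v` is a distributional derivative of `u` on `(a, b)`. -/
structure HasWeakDeriv (a b : ℝ) (u v : ℝ → ℝ) : Prop where
  locInt : LocallyIntegrableOn u (Ioo a b)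
  locInt_deriv : LocallyIntegrableOn v (Ioo a b)
  integral_eq : ∀ θ : ℝ → ℝ, ContDiff ℝ ∞ θ → HasCompactSupport θ → tsupport θ ⊆ Ioo a b →
    ∫ x in Ioo a b, u x * deriv θ x = -∫ x in Ioo a b, v x * θ x

/-- The functions in `L^p(a, b)`. -/
def lebesgueSpace (a b : ℝ) (p : ℝ≥0∞) : Set (ℝ → ℝ) := {u | MemLp u p (volIoo a b)}

/-- The functions in `W^{1,p}(a, b)`. -/
def sobolevSpace (a b : ℝ) (p : ℝ≥0∞) : Set (ℝ → ℝ) :=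
  {u | MemLp u p (volIoo a b) ∧ ∃ v, HasWeakDeriv a b u v ∧ MemLp v p (volIoo a b)}

/-- `W^{1,p}_*(a, b)`: the functions in `W^{1,p}(a, b)` whose continuous representative on
`[a, b]` vanishes at `a`. -/
def sobolevSpaceStar (a b : ℝ) (p : ℝ≥0∞) : Set (ℝ → ℝ) :=
  {u | u ∈ sobolevSpace a b p ∧
    ∃ w, ContinuousOn w (Icc a b) ∧ u =ᵐ[volIoo a b] w ∧ w a = 0}

/-- The norm `‖u‖_p` of `L^p(a, b)`, with values in `[0, ∞]`. -/
def lebesgueNorm (a b : ℝ) (p : ℝ≥0∞) (u : ℝ → ℝ) : ℝ≥0∞ := eLpNorm u p (volIoo a b)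

/-- The norm `‖u‖_p + ‖u'‖_p` of `W^{1,p}(a, b)`, with values in `[0, ∞]`. The weak derivative
`u'` is unique almost everywhere, so the infimum runs over equal numbers; it is `∞` if `u` has no
weak derivative. -/
def sobolevNorm (a b : ℝ) (p : ℝ≥0∞) (u : ℝ → ℝ) : ℝ≥0∞ :=
  ⨅ (v : ℝ → ℝ) (_ : HasWeakDeriv a b u v), eLpNorm u p (volIoo a b) + eLpNorm v p (volIoo a b)

/-- The family `T t`, `t ≥ 0`, is stable on the function space `X` with norm `N`:
`N (T t f) → 0` as `t → ∞` for every `f ∈ X`. -/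
def IsStableOn (T : ℝ → (ℝ → ℝ) → (ℝ → ℝ)) (X : Set (ℝ → ℝ)) (N : (ℝ → ℝ) → ℝ≥0∞) : Prop :=
  ∀ f ∈ X, Tendsto (fun t => N (T t f)) atTop (𝓝 0)

/-- The semiflow of `F x = -x ^ r` on `(0, 1)` is well defined: forward solutions exist. -/
theorem exists_isForwardSolution {r x : ℝ} (hr : 1 < r) (hx : x ∈ Ioo (0 : ℝ) 1) :
    IsForwardSolution (fun y => -y ^ r) (Ioo 0 1) x
      (fun t => ((r - 1) * t + x ^ (1 - r)) ^ (1 / (1 - r))) := by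
  have h1 : 1 - r ≠ 0 := by linarith
  have hone : 1 < x ^ (1 - r) := Real.one_lt_rpow_of_pos_of_lt_one_of_neg hx.1 hx.2 (by linarith)
  have hb : ∀ t, 0 ≤ t → 1 < (r - 1) * t + x ^ (1 - r) := fun t ht => by
    have := mul_nonneg (by linarith : (0 : ℝ) ≤ r - 1) ht
    linarith
  refine ⟨?_, fun t ht => ⟨?_, ?_⟩, fun t ht => ?_⟩
  · simp only [mul_zero, zero_add]
    rw [← Real.rpow_mul hx.1.le, mul_one_div_cancel h1, Real.rpow_one]
  · exact Real.rpow_pos_of_pos (by linarith [hb t ht]) _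
  · exact Real.rpow_lt_one_of_one_lt_of_neg (hb t ht) (one_div_neg.2 (by linarith))
  · have hpos : 0 < (r - 1) * t + x ^ (1 - r) := by linarith [hb t ht]
    have hd : HasDerivAt (fun t : ℝ => (r - 1) * t + x ^ (1 - r)) (r - 1) t := by
      simpa using ((hasDerivAt_id t).const_mul (r - 1)).add_const (x ^ (1 - r))
    refine ((hd.rpow_const (p := 1 / (1 - r)) (Or.inl hpos.ne')).congr_deriv ?_).hasDerivWithinAt
    rw [← Real.rpow_mul hpos.le]
    have e : 1 / (1 - r) * r = 1 / (1 - r) - 1 := by field_simp; ring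
    have e2 : (r - 1) * (1 / (1 - r)) = -1 := by field_simp; ring
    rw [e, e2]; ring

/-- The semiflow of `F x = -x ^ r` on `(0, 1)` is well defined: forward solutions are unique. -/
theorem IsForwardSolution.eq {r x : ℝ} (hr : 1 < r) {γ : ℝ → ℝ}
    (hγ : IsForwardSolution (fun y => -y ^ r) (Ioo 0 1) x γ) {t : ℝ} (ht : 0 ≤ t) :
    γ t = ((r - 1) * t + x ^ (1 - r)) ^ (1 / (1 - r)) := by
  have h1 : 1 - r ≠ 0 := by linarith
  have key : ∀ s, 0 ≤ s →
      HasDerivWithinAt (fun s => γ s ^ (1 - r) - (r - 1) * s) 0 (Ici 0) s := fun s hs => by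
    have hp := (hγ.mem s hs).1
    have hd := ((hγ.hasDeriv s hs).rpow_const (p := 1 - r) (Or.inl hp.ne')).sub
      ((hasDerivWithinAt_id s (Ici 0)).const_mul (r - 1))
    refine hd.congr_deriv ?_
    have e : γ s ^ r * γ s ^ (1 - r - 1) = 1 := by
      rw [← Real.rpow_add hp]; simp
    linear_combination (r - 1) * e
  have hc := constant_of_has_deriv_right_zero (a := 0) (b := t)
    (f := fun s => γ s ^ (1 - r) - (r - 1) * s)
    (fun s hs => ((key s hs.1).continuousWithinAt).mono Icc_subset_Ici_self)
    (fun s hs => (key s hs.1).mono (Ici_subset_Ici.2 hs.1)) t (right_mem_Icc.2 ht)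
  simp only [hγ.initial, mul_zero, sub_zero] at hc
  have hp := (hγ.mem t ht).1
  rw [show (r - 1) * t + x ^ (1 - r) = γ t ^ (1 - r) by linarith, ← Real.rpow_mul hp.le,
    mul_one_div_cancel h1, Real.rpow_one]

end

/-! The flow is explicit, `φ_t(x)^(1-r) = x^(1-r) + (r-1)t`, so `φ_t'(x) = (φ_t(x)/x)^r ≤ 1`.
Substituting `y = φ_s(x)` turns the weight into `E_t(x) = exp ∫_{φ_t(x)}^x h(y)/y^r dy`.

(a) Here `h(y)/y^r = h(0)/y + L¹`, so `E_t` is comparable to `(φ_t(x)/x)^(-h(0))` uniformly in `t`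
and `x` (`exists_weight_bounds`). The critical exponent is `r/p`, because `(φ_t')^(1/p) (f ∘ φ_t)`
has exactly the norm of `f` on `(0, φ_t(1))` (`eLpNorm_powerFlow`), which tends to zero. If `-h(0) ≥
r/p`, the semigroup is dominated by this operator. If `-h(0) < r/p`, it magnifies the mass of `f` on
`φ_t((1/2,1))` by a factor that tends to infinity, and an `f` with geometrically small mass on such
sets along a sequence of times (`exists_memLp_le_setLIntegral`) violates stability.

(b) Since `∫_{φ_t(x)}^x y^(-r) dy = t`, the weight lies within factors `exp(±C)` of `exp(h(0)t)`
(`abs_integral_sub_le`). Write `f = c + ∫_0^x v` by `HasWeakDeriv.exists_ae_eq_primitive`. Then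
`(T(t)f)' = E_t' (f ∘ φ_t) + E_t φ_t' (v ∘ φ_t)` with `|E_t'| ≤ 2C E_t`. For `h(0) ≤ 0` the last
term vanishes in the limit as in (a), while the rest is of size `exp(h(0)t)(|c| + o(1))`. The
functions `1` and `x` show that the conditions are necessary. -/

section

/-! ### Weak derivatives and primitives -/

/-- Integration by parts of a primitive against a compactly supported `C¹` function. -/
theorem setIntegral_primitive_mul_deriv {a b : ℝ} (hab : a < b) {w : ℝ → ℝ}
    (hw : IntegrableOn w (Ioo a b)) (c : ℝ) {η : ℝ → ℝ} (hη : ContDiff ℝ 1 η)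
    (hs : tsupport η ⊆ Ioo a b) :
    ∫ x in Ioo a b, (c + ∫ y in a..x, w y) * deriv η x = -∫ x in Ioo a b, w x * η x := by
  have hwi : IntervalIntegrable w volume a b := by
    rwa [intervalIntegrable_iff_integrableOn_Ioo_of_le hab.le]
  -- `w` is merely integrable, so integration by parts goes through absolute continuity.
  have hac : AbsolutelyContinuousOnInterval (fun x => c + ∫ y in a..x, w y) a b :=
    (contDiff_const (c := c) (n := 1)).contDiffOn.absolutelyContinuousOnInterval.fun_add
      (hwi.absolutelyContinuousOnInterval_intervalIntegral left_mem_uIcc)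
  have hηac : AbsolutelyContinuousOnInterval η a b := hη.contDiffOn.absolutelyContinuousOnInterval
  have ha : η a = 0 := image_eq_zero_of_notMem_tsupport fun h => lt_irrefl _ (hs h).1
  have hb : η b = 0 := image_eq_zero_of_notMem_tsupport fun h => lt_irrefl _ (hs h).2
  have key := hac.integral_mul_deriv_eq_deriv_mul hηac
  rw [ha, hb, mul_zero, mul_zero, sub_zero, zero_sub] at key
  have hd : ∫ x in a..b, deriv (fun x => c + ∫ y in a..x, w y) x * η x
      = ∫ x in a..b, w x * η x := by
    refine intervalIntegral.integral_congr_ae ?_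
    filter_upwards [hwi.ae_hasDerivAt_integral] with x hx hxm
    rw [((hx (uIoc_subset_uIcc hxm) a left_mem_uIcc).const_add c).deriv]
  rw [hd, intervalIntegral.integral_of_le hab.le, intervalIntegral.integral_of_le hab.le,
    integral_Ioc_eq_integral_Ioo, integral_Ioc_eq_integral_Ioo] at key
  exact key

theorem continuousOn_primitive_Icc {a b : ℝ} (hab : a < b) {w : ℝ → ℝ}
    (hw : IntegrableOn w (Ioo a b)) (c : ℝ) :
    ContinuousOn (fun x => c + ∫ y in a..x, w y) (Icc a b) := by
  refine continuousOn_const.add ?_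
  have := intervalIntegral.continuousOn_primitive_interval (μ := volume) (f := w) (a := a) (b := b)
    (by rw [uIcc_of_le hab.le, integrableOn_Icc_iff_integrableOn_Ioo]; exact hw)
  rwa [uIcc_of_le hab.le] at this

/-- The product of a `C¹` function and a primitive is weakly differentiable. -/
theorem hasWeakDeriv_mul_primitive {a b : ℝ} (hab : a < b) {w : ℝ → ℝ}
    (hw : IntegrableOn w (Ioo a b)) (c : ℝ) {E E' u v : ℝ → ℝ}
    (hE : ∀ x ∈ Ioo a b, HasDerivAt E (E' x) x) (hE' : ContinuousOn E' (Ioo a b))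
    (hu : ∀ᵐ x ∂(volIoo a b), u x = E x * (c + ∫ y in a..x, w y))
    (hv : ∀ᵐ x ∂(volIoo a b), v x = E' x * (c + ∫ y in a..x, w y) + E x * w x) :
    HasWeakDeriv a b u v := by
  have hEc : ContinuousOn E (Ioo a b) := fun x hx => (hE x hx).continuousAt.continuousWithinAt
  have hG := (continuousOn_primitive_Icc hab hw c).mono Ioo_subset_Icc_self
  have hul : LocallyIntegrableOn u (Ioo a b) := by
    have h1 : LocallyIntegrableOn (fun x => E x * (c + ∫ y in a..x, w y)) (Ioo a b) :=
      (hEc.mul hG).locallyIntegrableOn measurableSet_Ioo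
    rw [locallyIntegrableOn_iff isOpen_Ioo.isLocallyClosed] at h1 ⊢
    intro k hk hkc
    exact (h1 k hk hkc).congr (ae_restrict_of_ae_restrict_of_subset hk (hu.mono fun x h => h.symm))
  have hvl : LocallyIntegrableOn v (Ioo a b) := by
    rw [locallyIntegrableOn_iff isOpen_Ioo.isLocallyClosed]
    intro k hk hkc
    refine Integrable.congr ?_
      (ae_restrict_of_ae_restrict_of_subset hk (hv.mono fun x h => h.symm))
    exact (((hE'.mul hG).mono hk).integrableOn_compact hkc).add
      ((hw.mono_set hk).continuousOn_mul (hEc.mono hk) hkc)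
  refine ⟨hul, hvl, fun θ hθ hθc hθs => ?_⟩
  have hθd : ∀ x, HasDerivAt θ (deriv θ x) x := fun x =>
    (hθ.differentiable (by simp) x).hasDerivAt
  have hηs : tsupport (fun x => E x * θ x) ⊆ tsupport θ := closure_mono fun x hx => by
    simp only [Function.mem_support] at hx ⊢
    exact right_ne_zero_of_mul hx
  have hout : ∀ x ∉ tsupport θ, θ x = 0 ∧ deriv θ x = 0 := fun x hx =>
    ⟨image_eq_zero_of_notMem_tsupport hx,
      image_eq_zero_of_notMem_tsupport fun h => hx (tsupport_deriv_subset h)⟩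
  -- The factor `E` is moved onto the test function. It is differentiable only inside `(a, b)`, but
  -- `E θ` is `C¹` on the whole line because `θ` vanishes near every point outside its support.
  have hηd : ∀ x, HasDerivAt (fun x => E x * θ x) (E' x * θ x + E x * deriv θ x) x := by
    intro x
    by_cases hx : x ∈ tsupport θ
    · exact (hE x (hθs hx)).mul (hθd x)
    · rw [(hout x hx).1, (hout x hx).2, mul_zero, mul_zero, add_zero]
      refine (hasDerivAt_const x (0 : ℝ)).congr_of_eventuallyEq ?_
      filter_upwards [(isClosed_tsupport θ).isOpen_compl.mem_nhds hx] with y hy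
      simp [(hout y hy).1]
  have hηc : Continuous (fun x => E' x * θ x + E x * deriv θ x) := by
    rw [continuous_iff_continuousAt]
    intro x
    by_cases hx : x ∈ tsupport θ
    · have hn : Ioo a b ∈ 𝓝 x := isOpen_Ioo.mem_nhds (hθs hx)
      exact ((hE'.continuousAt hn).mul hθ.continuous.continuousAt).add
        ((hEc.continuousAt hn).mul (hθ.continuous_deriv (by simp)).continuousAt)
    · refine (continuousAt_const (y := (0 : ℝ))).congr ?_
      filter_upwards [(isClosed_tsupport θ).isOpen_compl.mem_nhds hx] with y hy
      simp [(hout y hy).1, (hout y hy).2]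
  have hderiv : deriv (fun x => E x * θ x) = fun x => E' x * θ x + E x * deriv θ x :=
    funext fun x => (hηd x).deriv
  have hη1 : ContDiff ℝ 1 (fun x => E x * θ x) :=
    contDiff_one_iff_deriv.2 ⟨fun x => (hηd x).differentiableAt, by rwa [hderiv]⟩
  have key := setIntegral_primitive_mul_deriv hab hw c hη1 (hηs.trans hθs)
  rw [hderiv] at key
  have hzero : ∀ F : ℝ → ℝ, ∫ x in Ioo a b, F x * θ x = ∫ x in tsupport θ, F x * θ x := fun F =>
    (setIntegral_eq_of_subset_of_forall_sdiff_eq_zero measurableSet_Ioo hθs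
      fun x hx => by rw [(hout x hx.2).1, mul_zero])
  have i1 : IntegrableOn (fun x => (E' x * (c + ∫ y in a..x, w y)) * θ x) (Ioo a b) := by
    refine IntegrableOn.of_forall_sdiff_eq_zero (s := tsupport θ) ?_ measurableSet_Ioo
      fun x hx => by rw [(hout x hx.2).1, mul_zero]
    exact (((hE'.mul hG).mono hθs).mul hθ.continuous.continuousOn).integrableOn_compact hθc
  have i2 : IntegrableOn (fun x => (E x * w x) * θ x) (Ioo a b) := by
    refine IntegrableOn.of_forall_sdiff_eq_zero (s := tsupport θ) ?_ measurableSet_Ioo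
      fun x hx => by rw [(hout x hx.2).1, mul_zero]
    exact ((hw.mono_set hθs).continuousOn_mul (hEc.mono hθs) hθc).mul_continuousOn
      hθ.continuous.continuousOn hθc
  have i3 : IntegrableOn (fun x => (E x * (c + ∫ y in a..x, w y)) * deriv θ x) (Ioo a b) := by
    refine IntegrableOn.of_forall_sdiff_eq_zero (s := tsupport θ) ?_ measurableSet_Ioo
      fun x hx => by rw [(hout x hx.2).2, mul_zero]
    exact (((hEc.mul hG).mono hθs).mul
      (hθ.continuous_deriv (by simp)).continuousOn).integrableOn_compact hθc
  have e1 : ∫ x in Ioo a b, u x * deriv θ x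
      = ∫ x in Ioo a b, (E x * (c + ∫ y in a..x, w y)) * deriv θ x :=
    integral_congr_ae (hu.mono fun x hx => by simp only [hx])
  have e2 : ∫ x in Ioo a b, v x * θ x = (∫ x in Ioo a b, (E' x * (c + ∫ y in a..x, w y)) * θ x)
      + ∫ x in Ioo a b, (E x * w x) * θ x := by
    rw [← integral_add i1 i2]
    exact integral_congr_ae (hv.mono fun x hx => by simp only [hx]; ring)
  have e3 : ∫ x in Ioo a b, (c + ∫ y in a..x, w y) * (E' x * θ x + E x * deriv θ x)
      = (∫ x in Ioo a b, (E' x * (c + ∫ y in a..x, w y)) * θ x)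
      + ∫ x in Ioo a b, (E x * (c + ∫ y in a..x, w y)) * deriv θ x := by
    rw [← integral_add i1 i3]
    exact integral_congr_ae (Eventually.of_forall fun x => by ring)
  have e4 : ∫ x in Ioo a b, w x * (E x * θ x) = ∫ x in Ioo a b, (E x * w x) * θ x :=
    integral_congr_ae (Eventually.of_forall fun x => by ring)
  rw [e3, e4] at key
  rw [e1, e2]
  linarith

/-- A test function on `(a, b)` with vanishing integral is the derivative of a test function. -/
theorem exists_testFunction_deriv_eq {a b : ℝ} {ζ : ℝ → ℝ} (hζ : ContDiff ℝ ∞ ζ)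
    (hζc : HasCompactSupport ζ) (hζs : tsupport ζ ⊆ Ioo a b) (hint : ∫ x, ζ x = 0) :
    ∃ θ : ℝ → ℝ, ContDiff ℝ ∞ θ ∧ HasCompactSupport θ ∧ tsupport θ ⊆ Ioo a b ∧ deriv θ = ζ := by
  rcases (tsupport ζ).eq_empty_or_nonempty with he | hne
  · have h0 : ζ = 0 := by rwa [tsupport_eq_empty_iff] at he
    exact ⟨0, contDiff_const, HasCompactSupport.zero, by simp [tsupport_zero],
      by rw [h0]; exact funext fun x => deriv_const x (0 : ℝ)⟩
  have hcpt : IsCompact (tsupport ζ) := hζc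
  obtain ⟨c, hcm, hc⟩ := hcpt.exists_isLeast hne
  obtain ⟨d, hdm, hd⟩ := hcpt.exists_isGreatest hne
  have hlt : ∀ x, x < c → ζ x = 0 := fun x hx =>
    image_eq_zero_of_notMem_tsupport fun h => absurd (hc h) (not_le.2 hx)
  have hgt : ∀ x, d < x → ζ x = 0 := fun x hx =>
    image_eq_zero_of_notMem_tsupport fun h => absurd (hd h) (not_le.2 hx)
  have hi : Integrable ζ := hζ.continuous.integrable_of_hasCompactSupport hζc
  have hder : ∀ x, HasDerivAt (fun x => ∫ y in Iic x, ζ y) (ζ x) x := by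
    intro x
    have h1 : (fun x => ∫ y in Iic x, ζ y)
        = fun x => (∫ y in (0 : ℝ)..x, ζ y) + ∫ y in Iic (0 : ℝ), ζ y := by
      funext z
      rw [← intervalIntegral.integral_Iic_sub_Iic hi.integrableOn hi.integrableOn]
      ring
    rw [h1]
    exact (hζ.continuous.integral_hasStrictDerivAt 0 x).hasDerivAt.add_const _
  have hderiv : deriv (fun x => ∫ y in Iic x, ζ y) = ζ := funext fun x => (hder x).deriv
  -- The primitive from `-∞` vanishes to the left of the support of `ζ` trivially, and to the right
  -- because the total integral is zero.
  have hsupp : Function.support (fun x => ∫ y in Iic x, ζ y) ⊆ Icc c d := by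
    intro x hx
    by_contra hn
    refine hx ?_
    rw [mem_Icc, not_and_or, not_le, not_le] at hn
    rcases hn with hn | hn
    · exact setIntegral_eq_zero_of_forall_eq_zero fun y hy => hlt y (lt_of_le_of_lt hy hn)
    · change ∫ y in Iic x, ζ y = 0
      rw [setIntegral_eq_integral_of_forall_compl_eq_zero (s := Iic x)
        fun y hy => hgt y (hn.trans (not_le.1 hy)), hint]
  have hts : tsupport (fun x => ∫ y in Iic x, ζ y) ⊆ Icc c d :=
    closure_minimal hsupp isClosed_Icc
  refine ⟨fun x => ∫ y in Iic x, ζ y, ?_, ?_, hts.trans (Icc_subset_Ioo (hζs hcm).1 (hζs hdm).2),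
    hderiv⟩
  · exact contDiff_infty_iff_deriv.2 ⟨fun x => (hder x).differentiableAt, by rwa [hderiv]⟩
  · exact HasCompactSupport.of_support_subset_isCompact isCompact_Icc hsupp

/-- The Du Bois-Reymond lemma: a function with integrable weak derivative is a primitive. -/
theorem HasWeakDeriv.exists_ae_eq_primitive {a b : ℝ} (hab : a < b) {u v : ℝ → ℝ}
    (huv : HasWeakDeriv a b u v) (hv : IntegrableOn v (Ioo a b)) :
    ∃ c : ℝ, ∀ᵐ x ∂(volIoo a b), u x = c + ∫ y in a..x, v y := by
  obtain ⟨f, hfs, hfc, hfd, hfr, hfx⟩ :=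
    exists_contDiff_tsupport_subset (n := (⊤ : ℕ∞)) (isOpen_Ioo.mem_nhds
      (show (a + b) / 2 ∈ Ioo a b by constructor <;> linarith))
  have hK : 0 < ∫ x, f x := hfd.continuous.integral_pos_of_hasCompactSupport_nonneg_nonzero hfc
    (fun x => (hfr (mem_range_self x)).1) (x := (a + b) / 2) (by rw [hfx]; exact one_ne_zero)
  set K := ∫ x, f x with hKdef
  set P : ℝ → ℝ := fun x => ∫ y in a..x, v y with hP
  have hPc : ContinuousOn P (Ioo a b) := by
    simpa using (continuousOn_primitive_Icc hab hv 0).mono Ioo_subset_Icc_self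
  have hUl : LocallyIntegrableOn (fun x => u x - P x) (Ioo a b) :=
    huv.locInt.sub (hPc.locallyIntegrableOn measurableSet_Ioo)
  have hUi : ∀ g : ℝ → ℝ, Continuous g → HasCompactSupport g → tsupport g ⊆ Ioo a b →
      ∀ F : ℝ → ℝ, LocallyIntegrableOn F (Ioo a b) →
      IntegrableOn (fun x => F x * g x) (Ioo a b) := fun g hg hgc hgs F hF => by
    refine IntegrableOn.of_forall_sdiff_eq_zero (s := tsupport g) ?_ measurableSet_Ioo
      fun x hx => by rw [image_eq_zero_of_notMem_tsupport hx.2, mul_zero]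
    exact (hF.integrableOn_compact_subset hgs hgc).mul_continuousOn hg.continuousOn hgc
  -- The only possible constant: test `u - P = c` against the bump `f`.
  set c := (∫ x in Ioo a b, (u x - P x) * f x) / K with hc
  refine ⟨c, ?_⟩
  have main := isOpen_Ioo.ae_eq_zero_of_integral_contDiff_smul_eq_zero (U := Ioo a b)
    (μ := volume) (f := fun x => (u x - P x) - c)
    (hUl.sub (continuousOn_const.locallyIntegrableOn measurableSet_Ioo)) ?_
  · rw [ae_restrict_iff' measurableSet_Ioo]
    filter_upwards [main] with x hx hxm
    linarith [hx hxm]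
  intro η hη hηc hηs
  have hηi : Integrable η := hη.continuous.integrable_of_hasCompactSupport hηc
  have hfi : Integrable f := hfd.continuous.integrable_of_hasCompactSupport hfc
  -- Subtracting `k f` makes the mean of `η` zero, so `η - k f` is the derivative of a test
  -- function, against which `u` and `P` have equal integrals.
  set k := (∫ x, η x) / K with hk
  have hζs : tsupport (fun x => η x - k * f x) ⊆ Ioo a b := by
    refine (tsupport_sub η (fun x => k * f x)).trans (union_subset hηs ?_)
    refine (closure_mono fun x hx => ?_).trans hfs
    exact right_ne_zero_of_mul hx
  obtain ⟨θ, hθ, hθc, hθs, hθd⟩ := exists_testFunction_deriv_eq (a := a) (b := b)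
    (ζ := fun x => η x - k * f x) (hη.sub (contDiff_const.mul hfd)) (hηc.sub hfc.mul_left) hζs (by
      rw [integral_sub hηi (hfi.const_mul k), integral_const_mul, ← hKdef, hk]
      field_simp; ring)
  have e1 := huv.integral_eq θ hθ hθc hθs
  have e2 := setIntegral_primitive_mul_deriv hab hv 0 (hθ.of_le (by simp)) hθs
  simp only [zero_add] at e2
  rw [hθd] at e1 e2
  have hζct : Continuous (fun x => η x - k * f x) :=
    hη.continuous.sub (continuous_const.mul hfd.continuous)
  have hζcs : HasCompactSupport (fun x => η x - k * f x) := hηc.sub hfc.mul_left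
  have e3 : ∫ x in Ioo a b, (u x - P x) * (η x - k * f x) = 0 := by
    have := integral_sub (hUi _ hζct hζcs hζs u huv.locInt)
      (hUi _ hζct hζcs hζs P (hPc.locallyIntegrableOn measurableSet_Ioo))
    rw [e1, e2, sub_self] at this
    rw [← this]
    exact integral_congr_ae (Eventually.of_forall fun x => by ring)
  have iη := hUi η hη.continuous hηc hηs _ hUl
  have if' := hUi f hfd.continuous hfc hfs _ hUl
  have e4 : ∫ x in Ioo a b, (u x - P x) * (η x - k * f x)
      = (∫ x in Ioo a b, (u x - P x) * η x) - k * ∫ x in Ioo a b, (u x - P x) * f x := by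
    rw [← integral_const_mul, ← integral_sub iη (if'.const_mul k)]
    exact integral_congr_ae (Eventually.of_forall fun x => by ring)
  have e5 : ∫ x in Ioo a b, η x = ∫ x, η x :=
    setIntegral_eq_integral_of_forall_compl_eq_zero fun x hx =>
      image_eq_zero_of_notMem_tsupport fun h => hx (hηs h)
  have e6 : ∫ x, η x • ((u x - P x) - c) = ∫ x in Ioo a b, η x • ((u x - P x) - c) :=
    (setIntegral_eq_integral_of_forall_compl_eq_zero fun x hx => by
      rw [image_eq_zero_of_notMem_tsupport fun h => hx (hηs h), zero_smul]).symm
  have e7 : ∫ x in Ioo a b, η x • ((u x - P x) - c)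
      = (∫ x in Ioo a b, (u x - P x) * η x) - c * ∫ x in Ioo a b, η x := by
    rw [← integral_const_mul, ← integral_sub iη (hηi.integrableOn.const_mul c)]
    exact integral_congr_ae (Eventually.of_forall fun x => by simp only [smul_eq_mul]; ring)
  rw [e6, e7, e5]
  have e8 : c * ∫ x, η x = k * ∫ x in Ioo a b, (u x - P x) * f x := by
    rw [hc, hk]; ring
  rw [e8]
  linarith

end

/-! ### The flow of `-x ^ r`, its change of variables and the weight -/

noncomputable section

/-- The explicit semiflow of `F x = -x ^ r` on `(0, ∞)`. -/
def powerFlow (r t x : ℝ) : ℝ := ((r - 1) * t + x ^ (1 - r)) ^ (1 / (1 - r))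

section PowerFlow

variable {r t x y : ℝ}

theorem powerFlow_base_pos (hr : 1 < r) (ht : 0 ≤ t) (hx : 0 < x) :
    0 < (r - 1) * t + x ^ (1 - r) :=
  add_pos_of_nonneg_of_pos (mul_nonneg (by linarith) ht) (Real.rpow_pos_of_pos hx _)

theorem powerFlow_pos (hr : 1 < r) (ht : 0 ≤ t) (hx : 0 < x) : 0 < powerFlow r t x :=
  Real.rpow_pos_of_pos (powerFlow_base_pos hr ht hx) _

theorem powerFlow_rpow (hr : 1 < r) (ht : 0 ≤ t) (hx : 0 < x) :
    powerFlow r t x ^ (1 - r) = (r - 1) * t + x ^ (1 - r) := by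
  rw [powerFlow, ← Real.rpow_mul (powerFlow_base_pos hr ht hx).le,
    one_div_mul_cancel (by linarith), Real.rpow_one]

theorem powerFlow_zero (hr : 1 < r) (hx : 0 < x) : powerFlow r 0 x = x := by
  rw [powerFlow, mul_zero, zero_add, ← Real.rpow_mul hx.le, mul_one_div_cancel (by linarith),
    Real.rpow_one]

theorem powerFlow_le_self (hr : 1 < r) (ht : 0 ≤ t) (hx : 0 < x) : powerFlow r t x ≤ x := by
  have h := powerFlow_rpow hr ht hx
  by_contra! hlt
  have := Real.rpow_lt_rpow_of_neg hx hlt (show 1 - r < 0 by linarith)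
  nlinarith [mul_nonneg (show 0 ≤ r - 1 by linarith) ht]

theorem powerFlow_strictMonoOn (hr : 1 < r) (ht : 0 ≤ t) :
    StrictMonoOn (powerFlow r t) (Ioi 0) := by
  intro x hx y hy hxy
  refine Real.rpow_lt_rpow_of_neg (powerFlow_base_pos hr ht hy) ?_
    (one_div_neg.2 (by linarith))
  exact (add_lt_add_iff_left _).2 (Real.rpow_lt_rpow_of_neg hx hxy (by linarith))

theorem powerFlow_mem (hr : 1 < r) (ht : 0 ≤ t) (hx : x ∈ Ioo (0 : ℝ) 1) :
    powerFlow r t x ∈ Ioo (0 : ℝ) 1 :=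
  ⟨powerFlow_pos hr ht hx.1, (powerFlow_le_self hr ht hx.1).trans_lt hx.2⟩

/-- Differentiating `φ_t(x)^(1-r) = x^(1-r) + (r-1)t` in `x` gives `φ_t^(-r) φ_t' = x^(-r)`. In this
form the Jacobian is a power of `φ_t(x)/x`, the quantity that also governs the weight in (a). -/
theorem hasDerivAt_powerFlow (hr : 1 < r) (ht : 0 ≤ t) (hx : 0 < x) :
    HasDerivAt (powerFlow r t) ((powerFlow r t x / x) ^ r) x := by
  have hb := powerFlow_base_pos hr ht hx
  have hd := (((Real.hasDerivAt_rpow_const (p := 1 - r) (Or.inl hx.ne')).const_add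
    ((r - 1) * t)).rpow_const (p := 1 / (1 - r)) (Or.inl hb.ne'))
  refine hd.congr_deriv ?_
  have h1 : 1 - r ≠ 0 := by linarith
  have e1 : powerFlow r t x ^ r = ((r - 1) * t + x ^ (1 - r)) ^ (1 / (1 - r) - 1) := by
    rw [powerFlow, ← Real.rpow_mul hb.le]
    congr 1
    field_simp
    ring
  have e2 : x ^ (1 - r - 1) = (x ^ r)⁻¹ := by
    rw [← Real.rpow_neg hx.le]; congr 1; ring
  rw [Real.div_rpow (powerFlow_pos hr ht hx).le hx.le, e1, e2]
  field_simp

theorem measurable_powerFlow (r t : ℝ) : Measurable (powerFlow r t) :=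
  ((measurable_id.pow_const (1 - r)).const_add ((r - 1) * t)).pow_const (1 / (1 - r))

theorem image_powerFlow_Ioo (hr : 1 < r) (ht : 0 ≤ t) (hx : 0 < x) :
    powerFlow r t '' Ioo 0 x = Ioo 0 (powerFlow r t x) := by
  apply Subset.antisymm
  · rintro _ ⟨z, hz, rfl⟩
    exact ⟨powerFlow_pos hr ht hz.1, powerFlow_strictMonoOn hr ht hz.1 hx hz.2⟩
  · rintro y ⟨hy0, hy⟩
    have hyx : y < x := hy.trans_le (powerFlow_le_self hr ht hx)
    have hc : ContinuousOn (powerFlow r t) (Icc y x) := fun z hz =>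
      (hasDerivAt_powerFlow hr ht (hy0.trans_le hz.1)).continuousAt.continuousWithinAt
    obtain ⟨z, hz, hzy⟩ := intermediate_value_Icc hyx.le hc
      ⟨powerFlow_le_self hr ht hy0, hy.le⟩
    refine ⟨z, ⟨hy0.trans_le hz.1, lt_of_le_of_ne hz.2 ?_⟩, hzy⟩
    rintro rfl
    exact hy.ne hzy.symm

theorem tendsto_powerFlow (hr : 1 < r) (x : ℝ) :
    Tendsto (fun t => powerFlow r t x) atTop (𝓝 0) := by
  have h1 : Tendsto (fun t : ℝ => (r - 1) * t + x ^ (1 - r)) atTop atTop :=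
    tendsto_atTop_add_const_right _ _ (tendsto_id.const_mul_atTop (by linarith))
  have h2 := (tendsto_rpow_neg_atTop (y := 1 / (r - 1)) (by
    exact one_div_pos.2 (by linarith))).comp h1
  refine h2.congr fun t => ?_
  simp only [Function.comp, powerFlow]
  congr 1
  rw [← one_div_neg_eq_neg_one_div, neg_sub]

theorem semiflow_eq_powerFlow (hr : 1 < r) (ht : 0 ≤ t) (hx : x ∈ Ioo (0 : ℝ) 1) :
    semiflow (fun x => -x ^ r) (Ioo 0 1) t x = powerFlow r t x := by
  have hex : ∃ γ, IsForwardSolution (fun x => -x ^ r) (Ioo 0 1) x γ :=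
    ⟨_, exists_isForwardSolution hr hx⟩
  rw [semiflow, dif_pos hex]
  exact hex.choose_spec.eq hr ht

/-- Change of variables along the flow. -/
theorem lintegral_image_powerFlow (hr : 1 < r) (ht : 0 ≤ t) {s : Set ℝ} (hs : MeasurableSet s)
    (hs0 : s ⊆ Ioi 0) (g : ℝ → ℝ≥0∞) :
    ∫⁻ y in powerFlow r t '' s, g y
      = ∫⁻ x in s, ENNReal.ofReal ((powerFlow r t x / x) ^ r) * g (powerFlow r t x) := by
  rw [lintegral_image_eq_lintegral_abs_deriv_mul hs
    (fun x hx => (hasDerivAt_powerFlow hr ht (hs0 hx)).hasDerivWithinAt)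
    ((powerFlow_strictMonoOn hr ht).injOn.mono hs0)]
  refine setLIntegral_congr_fun hs fun x hx => ?_
  have hx0 : 0 < x := hs0 hx
  simp only [abs_of_nonneg (Real.rpow_nonneg
    (div_nonneg (powerFlow_pos hr ht hx0).le hx0.le) r)]

theorem lintegral_powerFlow (hr : 1 < r) (ht : 0 ≤ t) (g : ℝ → ℝ≥0∞) :
    ∫⁻ x in Ioo 0 1, ENNReal.ofReal ((powerFlow r t x / x) ^ r) * g (powerFlow r t x)
      = ∫⁻ y in Ioo 0 (powerFlow r t 1), g y := by
  rw [← lintegral_image_powerFlow hr ht measurableSet_Ioo fun x hx => hx.1,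
    image_powerFlow_Ioo hr ht one_pos]

theorem Ioo_powerFlow_subset (hr : 1 < r) (ht : 0 ≤ t) (hx : x ∈ Ioc (0 : ℝ) 1) :
    Ioo 0 (powerFlow r t x) ⊆ Ioo 0 1 :=
  Ioo_subset_Ioo_right ((powerFlow_le_self hr ht hx.1).trans hx.2)

/-- The Jacobian is strictly positive, so preimages of null sets under `φ_t` are null. This
transfers almost everywhere identities from `f` to `f ∘ φ_t`. -/
theorem ae_comp_powerFlow (hr : 1 < r) (ht : 0 ≤ t) {P : ℝ → Prop}
    (hP : ∀ᵐ y ∂(volIoo 0 1), P y) : ∀ᵐ x ∂(volIoo 0 1), P (powerFlow r t x) := by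
  set N := toMeasurable (volIoo 0 1) {y | ¬ P y} with hN
  have hN0 : volIoo 0 1 N = 0 := by rw [hN, measure_toMeasurable]; exact hP
  have hNm : MeasurableSet N := measurableSet_toMeasurable _ _
  have h1 := lintegral_powerFlow hr ht (N.indicator 1)
  have h2 : ∫⁻ y in Ioo 0 (powerFlow r t 1), N.indicator 1 y = 0 := by
    refine le_antisymm ?_ bot_le
    calc _ ≤ ∫⁻ y in Ioo 0 1, N.indicator 1 y :=
          lintegral_mono_set (Ioo_powerFlow_subset hr ht ⟨one_pos, le_rfl⟩)
      _ = 0 := by rw [lintegral_indicator_one hNm, hN0]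
  rw [h2, lintegral_eq_zero_iff] at h1
  · filter_upwards [h1, ae_restrict_mem measurableSet_Ioo] with x hx hxm
    have hpos : 0 < (powerFlow r t x / x) ^ r :=
      Real.rpow_pos_of_pos (div_pos (powerFlow_pos hr ht hxm.1) hxm.1) r
    simp only [Pi.zero_apply, mul_eq_zero, ENNReal.ofReal_eq_zero, not_le.2 hpos, false_or] at hx
    by_contra hn
    have hmem : powerFlow r t x ∈ N := subset_toMeasurable _ _ hn
    rw [indicator_of_mem hmem] at hx
    exact one_ne_zero hx
  · exact ((((measurable_powerFlow r t).div measurable_id).pow_const r).ennreal_ofReal).mul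
      ((measurable_one.indicator hNm).comp (measurable_powerFlow r t))

/-- The weight of the semigroup as an integral over the orbit. -/
theorem integral_semiflow (hr : 1 < r) (ht : 0 ≤ t) (hx : x ∈ Ioo (0 : ℝ) 1) {h : ℝ → ℝ}
    (hh : ContinuousOn h (Ioo 0 1)) :
    ∫ s in (0 : ℝ)..t, h (semiflow (fun x => -x ^ r) (Ioo 0 1) s x)
      = ∫ y in powerFlow r t x..x, h y / y ^ r := by
  have hsol := exists_isForwardSolution hr hx
  have hmem : ∀ s ∈ uIcc 0 t, powerFlow r s x ∈ Ioo (0 : ℝ) 1 := fun s hs => by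
    rw [uIcc_of_le ht] at hs
    exact powerFlow_mem hr hs.1 hx
  have hfc : ContinuousOn (fun s => powerFlow r s x) (uIcc 0 t) := fun s hs => by
    rw [uIcc_of_le ht] at hs ⊢
    exact (hsol.hasDeriv s hs.1).continuousWithinAt.mono Icc_subset_Ici_self
  have hrp : ContinuousOn (fun y : ℝ => y ^ r) (Ioo 0 1) :=
    continuousOn_id.rpow_const fun y hy => Or.inl hy.1.ne'
  -- Substitution `y = φ_s(x)`, `dy = -y^r ds`; the minus sign reverses the endpoints.
  have key := intervalIntegral.integral_comp_mul_deriv'' (a := 0) (b := t)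
    (f := fun s => powerFlow r s x) (f' := fun s => -(powerFlow r s x) ^ r)
    (g := fun y => h y / y ^ r) hfc
    (fun s hs => by
      rw [min_eq_left ht, max_eq_right ht] at hs
      exact (hsol.hasDeriv s hs.1.le).mono (Ioi_subset_Ici hs.1.le))
    (hrp.comp hfc hmem).neg
    ((hh.div hrp fun y hy => (Real.rpow_pos_of_pos hy.1 r).ne').mono
      (by rintro _ ⟨s, hs, rfl⟩; exact hmem s hs))
  rw [powerFlow_zero hr hx.1] at key
  rw [intervalIntegral.integral_symm x, ← key, ← intervalIntegral.integral_neg]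
  refine intervalIntegral.integral_congr fun s hs => ?_
  have hp := Real.rpow_pos_of_pos (hmem s hs).1 r
  have hs0 : 0 ≤ s := by rw [uIcc_of_le ht] at hs; exact hs.1
  simp only [Function.comp, semiflow_eq_powerFlow hr hs0 hx]
  field_simp

theorem vonFoersterLasota_apply (hr : 1 < r) (ht : 0 ≤ t) (hx : x ∈ Ioo (0 : ℝ) 1) {h : ℝ → ℝ}
    (hh : ContinuousOn h (Ioo 0 1)) (f : ℝ → ℝ) :
    vonFoersterLasota r h t f x
      = Real.exp (∫ y in powerFlow r t x..x, h y / y ^ r) * f (powerFlow r t x) := by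
  rw [vonFoersterLasota, weightedCompSemigroup, integral_semiflow hr ht hx hh,
    semiflow_eq_powerFlow hr ht hx]

/-- The travel time from `x` down to `φ_t(x)` at speed `y^r`: the case `h = 1` of the orbit
integral. -/
theorem integral_inv_rpow_powerFlow (hr : 1 < r) (ht : 0 ≤ t) (hx : x ∈ Ioo (0 : ℝ) 1) :
    ∫ y in powerFlow r t x..x, 1 / y ^ r = t := by
  rw [← integral_semiflow hr ht hx (h := fun _ => 1) continuousOn_const]
  simp

end PowerFlow

theorem hasDerivAt_primitive_of_continuousOn_Ioo {a b c x : ℝ} {k : ℝ → ℝ}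
    (hk : ContinuousOn k (Ioo a b)) (hc : c ∈ Ioo a b) (hx : x ∈ Ioo a b) :
    HasDerivAt (fun x => ∫ y in c..x, k y) (k x) x := by
  have hsub : uIcc c x ⊆ Ioo a b := (ordConnected_Ioo.uIcc_subset hc hx)
  exact intervalIntegral.integral_hasDerivAt_right (hk.mono hsub).intervalIntegrable
    (hk.stronglyMeasurableAtFilter isOpen_Ioo x hx) (hk.continuousAt (isOpen_Ioo.mem_nhds hx))

end

/-! ### Stability on `L^p` -/

section

variable {p r : ℝ}

theorem eLpNorm_ofReal_eq {α : Type*} [MeasurableSpace α] (hp : 1 ≤ p) (f : α → ℝ)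
    (μ : Measure α) :
    eLpNorm f (ENNReal.ofReal p) μ = (∫⁻ x, ‖f x‖ₑ ^ p ∂μ) ^ (1 / p) := by
  have hp0 : 0 < p := by linarith
  rw [eLpNorm_eq_lintegral_rpow_enorm_toReal (by simpa using hp0) ENNReal.ofReal_ne_top,
    ENNReal.toReal_ofReal hp0.le]

/-- The weighted composition operator `f ↦ (φ'_t)^(1/p) (f ∘ φ_t)` is isometric. -/
theorem eLpNorm_powerFlow (hp : 1 ≤ p) (hr : 1 < r) {t : ℝ} (ht : 0 ≤ t) (f : ℝ → ℝ) :
    eLpNorm (fun x => (powerFlow r t x / x) ^ (r / p) * f (powerFlow r t x))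
        (ENNReal.ofReal p) (volIoo 0 1)
      = eLpNorm f (ENNReal.ofReal p) (volIoo 0 (powerFlow r t 1)) := by
  have hp0 : 0 < p := by linarith
  rw [eLpNorm_ofReal_eq hp, eLpNorm_ofReal_eq hp,
    ← lintegral_powerFlow hr ht (fun y => ‖f y‖ₑ ^ p)]
  congr 1
  refine setLIntegral_congr_fun measurableSet_Ioo fun x hx => ?_
  have hq : 0 ≤ powerFlow r t x / x := div_nonneg (powerFlow_pos hr ht hx.1).le hx.1.le
  rw [enorm_mul, ENNReal.mul_rpow_of_nonneg _ _ hp0.le,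
    Real.enorm_of_nonneg (Real.rpow_nonneg hq _),
    ENNReal.ofReal_rpow_of_nonneg (Real.rpow_nonneg hq _) hp0.le, ← Real.rpow_mul hq,
    div_mul_cancel₀ _ hp0.ne']

/-- The `L^p` norm over shrinking intervals tends to zero. -/
theorem tendsto_eLpNorm_Ioo_powerFlow (hp : 1 ≤ p) (hr : 1 < r) {f : ℝ → ℝ}
    (hf : MemLp f (ENNReal.ofReal p) (volIoo 0 1)) :
    Tendsto (fun t => eLpNorm f (ENNReal.ofReal p) (volIoo 0 (powerFlow r t 1))) atTop (𝓝 0) := by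
  have hp0 : 0 < p := by linarith
  have hfin : ∫⁻ x, ‖f x‖ₑ ^ p ∂(volIoo 0 1) ≠ ⊤ := by
    have := lintegral_rpow_enorm_lt_top_of_eLpNorm_lt_top (by simpa using hp0)
      ENNReal.ofReal_ne_top hf.2
    rw [ENNReal.toReal_ofReal hp0.le] at this
    exact this.ne
  have hmeas : Tendsto (fun t => volIoo 0 1 (Ioo 0 (powerFlow r t 1))) atTop (𝓝 0) := by
    have h1 : Tendsto (fun t => ENNReal.ofReal (powerFlow r t 1)) atTop (𝓝 0) := by
      simpa using ENNReal.tendsto_ofReal (tendsto_powerFlow hr 1)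
    refine tendsto_of_tendsto_of_tendsto_of_le_of_le tendsto_const_nhds h1
      (fun _ => bot_le) fun t => ?_
    calc _ ≤ volume (Ioo 0 (powerFlow r t 1)) := Measure.restrict_apply_le _ _
      _ = _ := by rw [Real.volume_Ioo, sub_zero]
  have h2 := (tendsto_setLIntegral_zero hfin hmeas).ennrpow_const (1 / p)
  rw [ENNReal.zero_rpow_of_pos (by positivity)] at h2
  refine h2.congr' ?_
  filter_upwards [eventually_ge_atTop 0] with t ht
  rw [eLpNorm_ofReal_eq hp, Measure.restrict_restrict measurableSet_Ioo,
    inter_eq_left.2 (Ioo_powerFlow_subset hr ht ⟨one_pos, le_rfl⟩)]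

/-- Two-sided bound of the weight of the semigroup by a power of `φ_t(x) / x`. -/
theorem exists_weight_bounds (hr : 1 < r) {h : ℝ → ℝ}
    (hg : IntegrableOn (fun x => (h x - x ^ (r - 1) * h 0) / x ^ r) (Ioo 0 1)) :
    ∃ C : ℝ, ∀ t, 0 ≤ t → ∀ x ∈ Ioo (0 : ℝ) 1,
      Real.exp (-C) * (powerFlow r t x / x) ^ (-h 0)
        ≤ Real.exp (∫ y in powerFlow r t x..x, h y / y ^ r) ∧
      Real.exp (∫ y in powerFlow r t x..x, h y / y ^ r)
        ≤ Real.exp C * (powerFlow r t x / x) ^ (-h 0) := by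
  set g : ℝ → ℝ := fun x => (h x - x ^ (r - 1) * h 0) / x ^ r with hgdef
  -- With `h(y)/y^r = g(y) + h(0)/y`, the second term integrates to `h(0) log(x/φ_t(x))`, which
  -- yields the power, and the first contributes at most the `L¹` norm of `g`.
  refine ⟨∫ y in Ioo 0 1, ‖g y‖, fun t ht x hx => ?_⟩
  have hφ := powerFlow_mem hr ht hx
  have hle := powerFlow_le_self hr ht hx.1
  have hsub : Icc (powerFlow r t x) x ⊆ Ioo 0 1 := Icc_subset_Ioo hφ.1 hx.2
  have hgi : IntervalIntegrable g volume (powerFlow r t x) x := by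
    rw [intervalIntegrable_iff_integrableOn_Icc_of_le hle]
    exact hg.mono_set hsub
  have hli : IntervalIntegrable (fun y : ℝ => h 0 * (1 / y)) volume (powerFlow r t x) x := by
    refine ContinuousOn.intervalIntegrable ?_
    rw [uIcc_of_le hle]
    exact continuousOn_const.mul (continuousOn_const.div continuousOn_id
      fun y hy => (hsub hy).1.ne')
  have hsplit : ∫ y in powerFlow r t x..x, h y / y ^ r
      = (∫ y in powerFlow r t x..x, g y) + h 0 * Real.log (x / powerFlow r t x) := by
    rw [← integral_one_div_of_pos hφ.1 hx.1, ← intervalIntegral.integral_const_mul,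
      ← intervalIntegral.integral_add hgi hli]
    refine intervalIntegral.integral_congr fun y hy => ?_
    rw [uIcc_of_le hle] at hy
    have hy0 : 0 < y := (hsub hy).1
    have hyr : y ^ (r - 1) = y ^ r / y := by rw [Real.rpow_sub hy0, Real.rpow_one]
    have := Real.rpow_pos_of_pos hy0 r
    simp only [hgdef, hyr]
    field_simp
    ring
  have hbound : |∫ y in powerFlow r t x..x, g y| ≤ ∫ y in Ioo 0 1, ‖g y‖ := by
    rw [← Real.norm_eq_abs]
    refine (intervalIntegral.norm_integral_le_integral_norm hle).trans ?_
    rw [intervalIntegral.integral_of_le hle]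
    exact setIntegral_mono_set hg.norm (Eventually.of_forall fun y => norm_nonneg _)
      (Ioc_subset_Icc_self.trans hsub).eventuallyLE
  have hpow : (powerFlow r t x / x) ^ (-h 0) = Real.exp (h 0 * Real.log (x / powerFlow r t x)) := by
    rw [Real.rpow_def_of_pos (div_pos hφ.1 hx.1), ← inv_div x, Real.log_inv]
    congr 1
    ring
  obtain ⟨h1, h2⟩ := abs_le.1 hbound
  rw [hpow, hsplit, ← Real.exp_add, ← Real.exp_add, Real.exp_le_exp, Real.exp_le_exp]
  constructor <;> linarith

/-- As `φ_t(x)/x ≤ 1` and `-h(0) ≥ r/p`, the weight is at most `exp C` times `(φ_t(x)/x)^(r/p)`, the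
weight of the isometric operator. -/
theorem isStableOn_lebesgueSpace (hp : 1 ≤ p) (hr : 1 < r) {h : ℝ → ℝ}
    (hh : ContinuousOn h (Ioo 0 1))
    (hg : IntegrableOn (fun x => (h x - x ^ (r - 1) * h 0) / x ^ r) (Ioo 0 1))
    (h0 : h 0 ≤ -r / p) :
    IsStableOn (vonFoersterLasota r h) (lebesgueSpace 0 1 (ENNReal.ofReal p))
      (lebesgueNorm 0 1 (ENNReal.ofReal p)) := by
  intro f hf
  obtain ⟨C, hC⟩ := exists_weight_bounds hr hg
  have hlim : Tendsto (fun t => ENNReal.ofReal (Real.exp C) *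
      eLpNorm f (ENNReal.ofReal p) (volIoo 0 (powerFlow r t 1))) atTop (𝓝 0) := by
    simpa using ENNReal.Tendsto.const_mul (a := ENNReal.ofReal (Real.exp C))
      (tendsto_eLpNorm_Ioo_powerFlow hp hr hf) (Or.inr ENNReal.ofReal_ne_top)
  refine tendsto_of_tendsto_of_tendsto_of_le_of_le' tendsto_const_nhds hlim
    (Eventually.of_forall fun _ => bot_le) ?_
  filter_upwards [eventually_ge_atTop 0] with t ht
  rw [← eLpNorm_powerFlow hp hr ht]
  refine eLpNorm_le_mul_eLpNorm_of_ae_le_mul ?_ _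
  filter_upwards [ae_restrict_mem measurableSet_Ioo] with x hx
  have hq : 0 < powerFlow r t x / x := div_pos (powerFlow_pos hr ht hx.1) hx.1
  have hq1 : powerFlow r t x / x ≤ 1 := (div_le_one hx.1).2 (powerFlow_le_self hr ht hx.1)
  rw [vonFoersterLasota_apply hr ht hx hh, norm_mul, norm_mul, ← mul_assoc,
    Real.norm_of_nonneg (Real.exp_nonneg _), Real.norm_of_nonneg (Real.rpow_nonneg hq.le _)]
  refine mul_le_mul_of_nonneg_right ((hC t ht x hx).2.trans ?_) (norm_nonneg _)
  refine mul_le_mul_of_nonneg_left ?_ (Real.exp_nonneg _)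
  exact Real.rpow_le_rpow_of_exponent_ge hq hq1 (by rw [neg_div] at h0; linarith)

/-- There is an `L^p` function with prescribed geometric mass on each set of a given sequence. -/
theorem exists_memLp_le_setLIntegral {α : Type*} [MeasurableSpace α] {μ : Measure α} (hp : 1 ≤ p)
    {s : ℕ → Set α} (hs : ∀ n, MeasurableSet (s n)) (hs0 : ∀ n, μ (s n) ≠ 0)
    (hst : ∀ n, μ (s n) ≠ ⊤) :
    ∃ f : α → ℝ, MemLp f (ENNReal.ofReal p) μ ∧
      ∀ n, (2⁻¹ : ℝ≥0∞) ^ n ≤ ∫⁻ x in s n, ‖f x‖ₑ ^ p ∂μ := by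
  have hp0 : 0 < p := by linarith
  -- `f` will be `G^(1/p)`. The sets may overlap: all terms are nonnegative, so each one alone
  -- bounds `G` from below, and their integrals sum to `2`.
  set G : α → ℝ≥0∞ := fun x => ∑' n, (s n).indicator (fun _ => 2⁻¹ ^ n / μ (s n)) x with hG
  have hGm : Measurable G := Measurable.tsum fun n => measurable_const.indicator (hs n)
  have hGi : ∫⁻ x, G x ∂μ = 2 := by
    rw [lintegral_tsum fun n => (measurable_const.indicator (hs n)).aemeasurable]
    have : ∀ n, ∫⁻ x, (s n).indicator (fun _ => 2⁻¹ ^ n / μ (s n)) x ∂μ = (2⁻¹ : ℝ≥0∞) ^ n :=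
      fun n => by
        rw [lintegral_indicator_const (hs n), ENNReal.div_mul_cancel (hs0 n) (hst n)]
    simp only [this, ENNReal.tsum_geometric, ENNReal.one_sub_inv_two, inv_inv]
  have hGt : ∀ᵐ x ∂μ, G x < ⊤ := ae_lt_top hGm (by rw [hGi]; exact ENNReal.ofNat_ne_top)
  have hnorm : ∀ᵐ x ∂μ, ‖(G x).toReal ^ (1 / p)‖ₑ ^ p = G x := by
    filter_upwards [hGt] with x hx
    rw [Real.enorm_of_nonneg (Real.rpow_nonneg ENNReal.toReal_nonneg _),
      ENNReal.ofReal_rpow_of_nonneg (Real.rpow_nonneg ENNReal.toReal_nonneg _) hp0.le,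
      ← Real.rpow_mul ENNReal.toReal_nonneg, one_div_mul_cancel hp0.ne', Real.rpow_one,
      ENNReal.ofReal_toReal hx.ne]
  refine ⟨fun x => (G x).toReal ^ (1 / p), ⟨?_, ?_⟩, fun n => ?_⟩
  · exact (hGm.ennreal_toReal.pow_const _).aestronglyMeasurable
  · rw [eLpNorm_ofReal_eq hp, lintegral_congr_ae hnorm, hGi]
    exact ENNReal.rpow_lt_top_of_nonneg (by positivity) ENNReal.ofNat_ne_top
  · rw [lintegral_congr_ae (ae_restrict_of_ae hnorm)]
    calc (2⁻¹ : ℝ≥0∞) ^ n = ∫⁻ x in s n, 2⁻¹ ^ n / μ (s n) ∂μ := by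
          rw [setLIntegral_const, ENNReal.div_mul_cancel (hs0 n) (hst n)]
      _ ≤ ∫⁻ x in s n, G x ∂μ := by
          refine setLIntegral_mono hGm fun x hx => ?_
          refine le_trans ?_ (ENNReal.le_tsum n)
          rw [indicator_of_mem hx]

/-- The semigroup expands the mass on `φ_t((1/2, 1))`. -/
theorem le_eLpNorm_vonFoersterLasota (hp : 1 ≤ p) (hr : 1 < r) {h : ℝ → ℝ}
    (hh : ContinuousOn h (Ioo 0 1)) (h0 : 0 < p * h 0 + r) {t C : ℝ} (ht : 0 ≤ t)
    (hC : ∀ x ∈ Ioo (0 : ℝ) 1, Real.exp (-C) * (powerFlow r t x / x) ^ (-h 0)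
        ≤ Real.exp (∫ y in powerFlow r t x..x, h y / y ^ r)) (f : ℝ → ℝ) :
    ENNReal.ofReal (Real.exp (-C)) * (ENNReal.ofReal ((2 * powerFlow r t 1) ^ (-(p * h 0 + r))) *
      ∫⁻ y in powerFlow r t '' Ioo (1 / 2) 1, ‖f y‖ₑ ^ p) ^ (1 / p)
      ≤ eLpNorm (vonFoersterLasota r h t f) (ENNReal.ofReal p) (volIoo 0 1) := by
  have hp0 : 0 < p := by linarith
  rw [eLpNorm_ofReal_eq hp, lintegral_image_powerFlow hr ht measurableSet_Ioo
    (fun x hx => lt_trans (by norm_num) hx.1), ← lintegral_const_mul' _ _ ENNReal.ofReal_ne_top]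
  have hroot : ENNReal.ofReal (Real.exp (-C))
      = (ENNReal.ofReal (Real.exp (-C)) ^ p) ^ (1 / p) := by
    rw [← ENNReal.rpow_mul, mul_one_div_cancel hp0.ne', ENNReal.rpow_one]
  rw [hroot, ← ENNReal.mul_rpow_of_nonneg _ _ (by positivity),
    ← lintegral_const_mul' _ _ (ENNReal.rpow_ne_top_of_nonneg hp0.le ENNReal.ofReal_ne_top)]
  refine ENNReal.rpow_le_rpow ?_ (by positivity)
  refine (setLIntegral_mono' measurableSet_Ioo fun x hx => ?_).trans
    (lintegral_mono_set (Ioo_subset_Ioo_left (by norm_num : (0 : ℝ) ≤ 1 / 2)))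
  have hx' : x ∈ Ioo (0 : ℝ) 1 := ⟨lt_trans (by norm_num) hx.1, hx.2⟩
  have hφ := powerFlow_pos hr ht hx'.1
  have hq : 0 < powerFlow r t x / x := div_pos hφ hx'.1
  have hq2 : powerFlow r t x / x ≤ 2 * powerFlow r t 1 := by
    rw [div_le_iff₀ hx'.1]
    have h1 : powerFlow r t x ≤ powerFlow r t 1 :=
      (powerFlow_strictMonoOn hr ht hx'.1 (mem_Ioi.2 one_pos) hx'.2).le
    nlinarith [hx.1, powerFlow_pos hr ht one_pos]
  rw [vonFoersterLasota_apply hr ht hx' hh, enorm_mul, ENNReal.mul_rpow_of_nonneg _ _ hp0.le,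
    ← mul_assoc, ← mul_assoc, Real.enorm_of_nonneg (Real.exp_nonneg _)]
  refine mul_le_mul_left ?_ _
  rw [ENNReal.ofReal_rpow_of_nonneg (Real.exp_nonneg _) hp0.le,
    ENNReal.ofReal_rpow_of_nonneg (Real.exp_nonneg _) hp0.le,
    ← ENNReal.ofReal_mul (by positivity),
    ← ENNReal.ofReal_mul (mul_nonneg (by positivity) (Real.rpow_nonneg
      (mul_nonneg zero_le_two (powerFlow_pos hr ht one_pos).le) _))]
  refine ENNReal.ofReal_le_ofReal ?_
  refine le_trans ?_ (Real.rpow_le_rpow (by positivity) (hC x hx') hp0.le)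
  rw [Real.mul_rpow (Real.exp_nonneg _) (Real.rpow_nonneg hq.le _), mul_assoc]
  refine mul_le_mul_of_nonneg_left ?_ (by positivity)
  -- The factor `(φ_t/x)^r` is the Jacobian consumed by the change of variables. The remaining
  -- exponent `-(p h(0) + r)` is negative, so the bound `φ_t(x)/x ≤ 2 φ_t(1)` becomes a lower bound.
  calc (2 * powerFlow r t 1) ^ (-(p * h 0 + r)) * (powerFlow r t x / x) ^ r
      ≤ (powerFlow r t x / x) ^ (-(p * h 0 + r)) * (powerFlow r t x / x) ^ r :=
        mul_le_mul_of_nonneg_right (Real.rpow_le_rpow_of_nonpos hq hq2 (by linarith))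
          (Real.rpow_nonneg hq.le _)
    _ = ((powerFlow r t x / x) ^ (-h 0)) ^ p := by
        rw [← Real.rpow_add hq, ← Real.rpow_mul hq.le]
        congr 1
        ring

theorem le_of_isStableOn_lebesgueSpace (hp : 1 ≤ p) (hr : 1 < r) {h : ℝ → ℝ}
    (hh : ContinuousOn h (Ioo 0 1))
    (hg : IntegrableOn (fun x => (h x - x ^ (r - 1) * h 0) / x ^ r) (Ioo 0 1))
    (hst : IsStableOn (vonFoersterLasota r h) (lebesgueSpace 0 1 (ENNReal.ofReal p))
      (lebesgueNorm 0 1 (ENNReal.ofReal p))) : h 0 ≤ -r / p := by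
  have hp0 : 0 < p := by linarith
  by_contra! hlt
  have h0 : 0 < p * h 0 + r := by
    rw [div_lt_iff₀ hp0] at hlt
    linarith
  obtain ⟨C, hC⟩ := exists_weight_bounds hr hg
  have hsmall : Tendsto (fun t => (2 * powerFlow r t 1) ^ (p * h 0 + r)) atTop (𝓝 0) := by
    have := ((tendsto_powerFlow hr 1).const_mul 2).rpow_const (p := p * h 0 + r) (Or.inr h0.le)
    rwa [mul_zero, Real.zero_rpow h0.ne'] at this
  -- At time `τ n` the magnification exceeds `2^n`, which cancels the mass `2^(-n)` of `f` on the
  -- corresponding image; `n ≤ τ n` forces `τ` to infinity.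
  have hex : ∀ n : ℕ, ∃ t : ℝ, (n : ℝ) ≤ t ∧
      (2 * powerFlow r t 1) ^ (p * h 0 + r) < (2⁻¹ : ℝ) ^ n := fun n =>
    ((eventually_ge_atTop (n : ℝ)).and (hsmall.eventually_lt_const (by positivity))).exists
  choose τ hτ hτs using hex
  have hτ0 : ∀ n, 0 ≤ τ n := fun n => (Nat.cast_nonneg n).trans (hτ n)
  have hsub : ∀ n, powerFlow r (τ n) '' Ioo (1 / 2) 1 ⊆ Ioo 0 1 := by
    rintro n _ ⟨x, hx, rfl⟩
    exact powerFlow_mem hr (hτ0 n) ⟨lt_trans (by norm_num) hx.1, hx.2⟩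
  have hIoi : Ioo (1 / 2 : ℝ) 1 ⊆ Ioi 0 := fun x hx => lt_trans (by norm_num) hx.1
  have hmeas : ∀ n, MeasurableSet (powerFlow r (τ n) '' Ioo (1 / 2) 1) := fun n =>
    measurableSet_Ioo.image_of_monotoneOn
      ((powerFlow_strictMonoOn hr (hτ0 n)).monotoneOn.mono hIoi)
  have hvol : ∀ n, volIoo 0 1 (powerFlow r (τ n) '' Ioo (1 / 2) 1)
      = volume (powerFlow r (τ n) '' Ioo (1 / 2) 1) := fun n =>
    Measure.restrict_eq_self _ (hsub n)
  have hvol0 : ∀ n, volIoo 0 1 (powerFlow r (τ n) '' Ioo (1 / 2) 1) ≠ 0 := fun n => by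
    rw [hvol]
    have hc : ContinuousOn (powerFlow r (τ n)) (Icc (1 / 2) 1) := fun z hz =>
      (hasDerivAt_powerFlow hr (hτ0 n)
        (lt_of_lt_of_le (by norm_num) hz.1)).continuousAt.continuousWithinAt
    have hlt : powerFlow r (τ n) (1 / 2) < powerFlow r (τ n) 1 :=
      powerFlow_strictMonoOn hr (hτ0 n) (mem_Ioi.2 (by norm_num)) (mem_Ioi.2 one_pos)
        (by norm_num)
    refine ((Measure.measure_Ioo_pos volume).2 hlt |>.trans_le (measure_mono ?_)).ne'
    exact intermediate_value_Ioo (by norm_num) hc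
  obtain ⟨f, hf, hfn⟩ := exists_memLp_le_setLIntegral (μ := volIoo 0 1) hp hmeas hvol0
    fun n => measure_ne_top _ _
  have hτt : Tendsto τ atTop atTop := tendsto_atTop_mono hτ tendsto_natCast_atTop_atTop
  have hlim := (hst f hf).comp hτt
  have hlow : ∀ n, ENNReal.ofReal (Real.exp (-C))
      ≤ lebesgueNorm 0 1 (ENNReal.ofReal p) (vonFoersterLasota r h (τ n) f) := fun n => by
    refine le_trans ?_ (le_eLpNorm_vonFoersterLasota hp hr hh h0 (hτ0 n)
      (fun x hx => (hC _ (hτ0 n) x hx).1) f)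
    refine le_mul_of_one_le_right' ?_
    rw [← ENNReal.one_rpow (1 / p)]
    refine ENNReal.rpow_le_rpow ?_ (by positivity)
    have hfn' := hfn n
    rw [Measure.restrict_restrict (hmeas n), inter_eq_left.2 (hsub n)] at hfn'
    have hb : 0 < 2 * powerFlow r (τ n) 1 := mul_pos two_pos (powerFlow_pos hr (hτ0 n) one_pos)
    have h2 : (2 : ℝ≥0∞) ^ n ≤ ENNReal.ofReal ((2 * powerFlow r (τ n) 1) ^ (-(p * h 0 + r))) := by
      have : (2 : ℝ≥0∞) ^ n = ENNReal.ofReal (2 ^ n) := by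
        rw [ENNReal.ofReal_pow zero_le_two, ENNReal.ofReal_ofNat]
      rw [this, Real.rpow_neg hb.le]
      refine ENNReal.ofReal_le_ofReal ?_
      rw [le_inv_comm₀ (by positivity) (Real.rpow_pos_of_pos hb _), ← inv_pow]
      exact (hτs n).le
    calc (1 : ℝ≥0∞) = 2 ^ n * 2⁻¹ ^ n := by
          rw [← mul_pow, ENNReal.mul_inv_cancel two_ne_zero ENNReal.ofNat_ne_top, one_pow]
      _ ≤ _ := mul_le_mul' h2 hfn'
  have := ge_of_tendsto' hlim hlow
  simp only [nonpos_iff_eq_zero, ENNReal.ofReal_eq_zero, not_le.2 (Real.exp_pos _)] at this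

end

/-! ### Stability on Sobolev spaces -/

section

variable {p r : ℝ}

/-- An essential bound of a continuous function holds everywhere. -/
theorem exists_forall_norm_le_of_memLp_top {a b : ℝ} {k : ℝ → ℝ} (hk : ContinuousOn k (Ioo a b))
    (hkm : MemLp k ⊤ (volIoo a b)) : ∃ C, 0 ≤ C ∧ ∀ x ∈ Ioo a b, |k x| ≤ C := by
  refine ⟨(eLpNorm k ⊤ (volIoo a b)).toReal, ENNReal.toReal_nonneg, fun x hx => ?_⟩
  set C := (eLpNorm k ⊤ (volIoo a b)).toReal with hC
  -- Taking the maximum turns an almost everywhere inequality into an almost everywhere equality of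
  -- continuous functions, which then holds at every point.
  have hae : (fun x => max |k x| C) =ᵐ[volume.restrict (Ioo a b)] fun _ => C := by
    filter_upwards [ae_le_eLpNormEssSup (f := k) (μ := volIoo a b)] with x hx
    refine max_eq_right ?_
    rw [← eLpNorm_exponent_top] at hx
    have := ENNReal.toReal_mono hkm.2.ne hx
    rwa [toReal_enorm, Real.norm_eq_abs] at this
  have := Measure.eqOn_open_of_ae_eq hae isOpen_Ioo (hk.abs.sup continuousOn_const)
    continuousOn_const hx
  exact (le_max_left _ _).trans this.le

section Weight

variable {h : ℝ → ℝ} {C : ℝ}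

/-- If `|h - h 0| ≤ C x ^ r`, the weight of the semigroup is comparable to `exp (h 0 * t)`. -/
theorem abs_integral_sub_le (hr : 1 < r) (hh : ContinuousOn h (Ioo 0 1)) (hC0 : 0 ≤ C)
    (hC : ∀ x ∈ Ioo (0 : ℝ) 1, |(h x - h 0) / x ^ r| ≤ C) {t x : ℝ} (ht : 0 ≤ t)
    (hx : x ∈ Ioo (0 : ℝ) 1) :
    |(∫ y in powerFlow r t x..x, h y / y ^ r) - h 0 * t| ≤ C := by
  have hφ := powerFlow_mem hr ht hx
  have hle := powerFlow_le_self hr ht hx.1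
  have hsub : uIcc (powerFlow r t x) x ⊆ Ioo 0 1 := by
    rw [uIcc_of_le hle]
    exact Icc_subset_Ioo hφ.1 hx.2
  have hrp : ContinuousOn (fun y : ℝ => y ^ r) (Ioo 0 1) :=
    continuousOn_id.rpow_const fun y hy => Or.inl hy.1.ne'
  have hrp0 : ∀ y ∈ Ioo (0 : ℝ) 1, y ^ r ≠ 0 := fun y hy => (Real.rpow_pos_of_pos hy.1 r).ne'
  have i1 : IntervalIntegrable (fun y => h y / y ^ r) volume (powerFlow r t x) x :=
    ((hh.div hrp hrp0).mono hsub).intervalIntegrable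
  have i2 : IntervalIntegrable (fun y => h 0 * (1 / y ^ r)) volume (powerFlow r t x) x :=
    ((continuousOn_const.mul (continuousOn_const.div hrp hrp0)).mono hsub).intervalIntegrable
  -- By the travel time identity `h(0) t` is the orbit integral of the constant `h(0)`. What remains
  -- has integrand bounded by `C` on an interval of length less than one.
  have e : (∫ y in powerFlow r t x..x, h y / y ^ r) - h 0 * t
      = ∫ y in powerFlow r t x..x, (h y - h 0) / y ^ r := by
    have e1 := intervalIntegral.integral_sub i1 i2
    rw [intervalIntegral.integral_const_mul, integral_inv_rpow_powerFlow hr ht hx] at e1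
    rw [← e1]
    exact intervalIntegral.integral_congr fun y _ => by ring
  rw [e, ← Real.norm_eq_abs]
  refine (intervalIntegral.norm_integral_le_of_norm_le_const (C := C) fun y hy =>
    hC y (hsub (uIoc_subset_uIcc hy))).trans ?_
  rw [abs_of_nonneg (sub_nonneg.2 hle)]
  nlinarith [hφ.1, hx.2]

/-- The lower endpoint contributes `(h(φ_t)/φ_t^r) φ_t' = h(φ_t)/x^r`. Only continuity of `h`
enters; no derivative of `h` appears. -/
theorem hasDerivAt_weight (hr : 1 < r) (hh : ContinuousOn h (Ioo 0 1)) {t x : ℝ} (ht : 0 ≤ t)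
    (hx : x ∈ Ioo (0 : ℝ) 1) :
    HasDerivAt (fun x => Real.exp (∫ y in powerFlow r t x..x, h y / y ^ r))
      (Real.exp (∫ y in powerFlow r t x..x, h y / y ^ r) *
        ((h x - h (powerFlow r t x)) / x ^ r)) x := by
  have hk : ContinuousOn (fun y => h y / y ^ r) (Ioo 0 1) :=
    hh.div (continuousOn_id.rpow_const fun y hy => Or.inl hy.1.ne')
      fun y hy => (Real.rpow_pos_of_pos hy.1 r).ne'
  have hm : (1 / 2 : ℝ) ∈ Ioo (0 : ℝ) 1 := by constructor <;> norm_num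
  have hi : ∀ z ∈ Ioo (0 : ℝ) 1, IntervalIntegrable (fun y => h y / y ^ r) volume (1 / 2) z :=
    fun z hz => (hk.mono (ordConnected_Ioo.uIcc_subset hm hz)).intervalIntegrable
  have hφ := powerFlow_mem hr ht hx
  have hd : HasDerivAt (fun x => (∫ y in (1 / 2 : ℝ)..x, h y / y ^ r)
      - ∫ y in (1 / 2 : ℝ)..powerFlow r t x, h y / y ^ r)
      ((h x - h (powerFlow r t x)) / x ^ r) x := by
    refine ((hasDerivAt_primitive_of_continuousOn_Ioo hk hm hx).sub
      ((hasDerivAt_primitive_of_continuousOn_Ioo hk hm hφ).comp x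
        (hasDerivAt_powerFlow hr ht hx.1))).congr_deriv ?_
    have := Real.rpow_pos_of_pos hx.1 r
    have := Real.rpow_pos_of_pos hφ.1 r
    rw [Real.div_rpow hφ.1.le hx.1.le]
    field_simp
  refine HasDerivAt.exp (hd.congr_of_eventuallyEq ?_)
  filter_upwards [isOpen_Ioo.mem_nhds hx] with z hz
  exact (intervalIntegral.integral_interval_sub_left (hi z hz)
    (hi _ (powerFlow_mem hr ht hz))).symm

end Weight

/-- Weak differentiability of `T(t) f` and the product formula for its derivative. -/
theorem hasWeakDeriv_vonFoersterLasota (hr : 1 < r) {h : ℝ → ℝ} (hh : ContinuousOn h (Ioo 0 1))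
    {t : ℝ} (ht : 0 ≤ t) {f v : ℝ → ℝ} {c : ℝ} (hv : IntegrableOn v (Ioo 0 1))
    (hf : ∀ᵐ x ∂(volIoo 0 1), f x = c + ∫ y in (0 : ℝ)..x, v y) :
    IntegrableOn (fun x => (powerFlow r t x / x) ^ r * v (powerFlow r t x)) (Ioo 0 1) ∧
    HasWeakDeriv 0 1 (vonFoersterLasota r h t f) (fun x =>
      Real.exp (∫ y in powerFlow r t x..x, h y / y ^ r) *
        ((h x - h (powerFlow r t x)) / x ^ r) * (c + ∫ y in (0 : ℝ)..powerFlow r t x, v y)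
      + Real.exp (∫ y in powerFlow r t x..x, h y / y ^ r) *
        ((powerFlow r t x / x) ^ r * v (powerFlow r t x))) := by
  have hder : ∀ z ∈ Ioc (0 : ℝ) 1, ∀ x ∈ Ioo 0 z,
      HasDerivWithinAt (powerFlow r t) ((powerFlow r t x / x) ^ r) (Ioo 0 z) x :=
    fun z _ x hx => (hasDerivAt_powerFlow hr ht hx.1).hasDerivWithinAt
  have hinj : ∀ z : ℝ, InjOn (powerFlow r t) (Ioo 0 z) := fun z =>
    (powerFlow_strictMonoOn hr ht).injOn.mono fun x hx => hx.1
  have habs : ∀ z : ℝ, EqOn (fun x => |(powerFlow r t x / x) ^ r| • v (powerFlow r t x))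
      (fun x => (powerFlow r t x / x) ^ r * v (powerFlow r t x)) (Ioo 0 z) := fun z x hx => by
    simp only [smul_eq_mul]
    rw [abs_of_nonneg (Real.rpow_nonneg (div_nonneg (powerFlow_pos hr ht hx.1).le hx.1.le) r)]
  have hw : IntegrableOn (fun x => (powerFlow r t x / x) ^ r * v (powerFlow r t x))
      (Ioo 0 1) := by
    rw [← integrableOn_congr_fun (habs 1) measurableSet_Ioo,
      ← integrableOn_image_iff_integrableOn_abs_deriv_smul measurableSet_Ioo
        (hder 1 ⟨one_pos, le_rfl⟩) (hinj 1), image_powerFlow_Ioo hr ht one_pos]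
    exact hv.mono_set (Ioo_powerFlow_subset hr ht ⟨one_pos, le_rfl⟩)
  -- As `φ_t` maps `(0, x)` onto `(0, φ_t(x))`, the function `f ∘ φ_t` is again a primitive from
  -- `0`, with the same constant `c`.
  have hprim : ∀ x ∈ Ioo (0 : ℝ) 1, ∫ y in (0 : ℝ)..powerFlow r t x, v y
      = ∫ s in (0 : ℝ)..x, (powerFlow r t s / s) ^ r * v (powerFlow r t s) := fun x hx => by
    rw [intervalIntegral.integral_of_le (powerFlow_pos hr ht hx.1).le,
      intervalIntegral.integral_of_le hx.1.le, integral_Ioc_eq_integral_Ioo,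
      integral_Ioc_eq_integral_Ioo, ← image_powerFlow_Ioo hr ht hx.1,
      integral_image_eq_integral_abs_deriv_smul measurableSet_Ioo
        (hder x ⟨hx.1, hx.2.le⟩) (hinj x)]
    exact setIntegral_congr_fun measurableSet_Ioo (habs x)
  refine ⟨hw, hasWeakDeriv_mul_primitive one_pos hw c
    (fun x hx => hasDerivAt_weight hr hh ht hx) ?_ ?_ ?_⟩
  · have hφc : ContinuousOn (powerFlow r t) (Ioo 0 1) := fun x hx =>
      (hasDerivAt_powerFlow hr ht hx.1).continuousAt.continuousWithinAt
    refine ContinuousOn.mul (fun x hx =>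
      (hasDerivAt_weight hr hh ht hx).continuousAt.continuousWithinAt) ?_
    exact (hh.sub (hh.comp hφc fun x hx => powerFlow_mem hr ht hx)).div
      (continuousOn_id.rpow_const fun y hy => Or.inl hy.1.ne')
      fun y hy => (Real.rpow_pos_of_pos hy.1 r).ne'
  · filter_upwards [ae_comp_powerFlow hr ht hf, ae_restrict_mem measurableSet_Ioo] with x hx hxm
    rw [vonFoersterLasota_apply hr ht hxm hh, hx, hprim x hxm]
  · filter_upwards [ae_restrict_mem measurableSet_Ioo] with x hxm
    rw [hprim x hxm]

theorem integrableOn_of_memLp (hp : 1 ≤ p) {a b : ℝ} {v : ℝ → ℝ}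
    (hv : MemLp v (ENNReal.ofReal p) (volIoo a b)) : IntegrableOn v (Ioo a b) :=
  hv.integrable (by simpa using hp)

/-- The three summands come from `T(t)f`, from `E_t' (f ∘ φ_t)` and from `E_t φ_t' (v ∘ φ_t)`. The
first two are supremum bounds on an interval of measure one. In the third, `φ_t' ≤ (φ_t')^(1/p)`
because `p ≥ 1`, and the isometric operator applies to `v`. -/
theorem sobolevNorm_vonFoersterLasota_le (hp : 1 ≤ p) (hr : 1 < r) {h : ℝ → ℝ} {C : ℝ}
    (hh : ContinuousOn h (Ioo 0 1)) (hC0 : 0 ≤ C)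
    (hC : ∀ x ∈ Ioo (0 : ℝ) 1, |(h x - h 0) / x ^ r| ≤ C) (h0 : h 0 ≤ 0) {t : ℝ} (ht : 0 ≤ t)
    {f v : ℝ → ℝ} {c : ℝ} (hv : MemLp v (ENNReal.ofReal p) (volIoo 0 1))
    (hf : ∀ᵐ x ∂(volIoo 0 1), f x = c + ∫ y in (0 : ℝ)..x, v y) :
    sobolevNorm 0 1 (ENNReal.ofReal p) (vonFoersterLasota r h t f)
      ≤ ENNReal.ofReal (Real.exp (h 0 * t + C) * (|c| + ∫ y in (0 : ℝ)..powerFlow r t 1, |v y|))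
      + (ENNReal.ofReal (2 * C *
          (Real.exp (h 0 * t + C) * (|c| + ∫ y in (0 : ℝ)..powerFlow r t 1, |v y|)))
      + ENNReal.ofReal (Real.exp C) *
        eLpNorm v (ENNReal.ofReal p) (volIoo 0 (powerFlow r t 1))) := by
  have hvi := integrableOn_of_memLp hp hv
  have hp0 : 0 < p := by linarith
  have hp1 : 1 ≤ ENNReal.ofReal p := by simpa using hp
  have hone : volIoo 0 1 univ = 1 := by simp
  have hφ1 := powerFlow_pos hr ht one_pos
  have hφ1' := powerFlow_le_self hr ht one_pos
  obtain ⟨hw, hwd⟩ := hasWeakDeriv_vonFoersterLasota hr hh ht hvi hf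
  have hE : ∀ x ∈ Ioo (0 : ℝ) 1, Real.exp (∫ y in powerFlow r t x..x, h y / y ^ r)
      ≤ Real.exp (h 0 * t + C) := fun x hx => by
    rw [Real.exp_le_exp]
    linarith [(abs_le.1 (abs_integral_sub_le hr hh hC0 hC ht hx)).2]
  have hG : ∀ x ∈ Ioo (0 : ℝ) 1, |c + ∫ y in (0 : ℝ)..powerFlow r t x, v y|
      ≤ |c| + ∫ y in (0 : ℝ)..powerFlow r t 1, |v y| := fun x hx => by
    have hφ := powerFlow_mem hr ht hx
    have hle : powerFlow r t x ≤ powerFlow r t 1 :=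
      (powerFlow_strictMonoOn hr ht hx.1 (mem_Ioi.2 one_pos) hx.2).le
    refine (abs_add_le _ _).trans (add_le_add_right ?_ _)
    refine (intervalIntegral.abs_integral_le_integral_abs hφ.1.le).trans ?_
    refine intervalIntegral.integral_mono_interval le_rfl hφ.1.le hle
      (Eventually.of_forall fun y => abs_nonneg _) ?_
    rw [intervalIntegrable_iff_integrableOn_Ioo_of_le hφ1.le]
    exact (hvi.mono_set (Ioo_powerFlow_subset hr ht ⟨one_pos, le_rfl⟩)).abs
  -- Compare both values with `h(0)`: the difference is at most `C x^r + C φ_t(x)^r ≤ 2 C x^r`.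
  have hq : ∀ x ∈ Ioo (0 : ℝ) 1, |(h x - h (powerFlow r t x)) / x ^ r| ≤ 2 * C := fun x hx => by
    have hφ := powerFlow_mem hr ht hx
    have hxr := Real.rpow_pos_of_pos hx.1 r
    have hφr := Real.rpow_pos_of_pos hφ.1 r
    have h1 := hC x hx
    have h2 := hC _ hφ
    rw [abs_div, abs_of_pos hxr, div_le_iff₀ hxr] at h1
    rw [abs_div, abs_of_pos hφr, div_le_iff₀ hφr] at h2
    rw [abs_div, abs_of_pos hxr, div_le_iff₀ hxr]
    have h3 : powerFlow r t x ^ r ≤ x ^ r :=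
      Real.rpow_le_rpow hφ.1.le (powerFlow_le_self hr ht hx.1) (by linarith)
    have h4 := mul_le_mul_of_nonneg_left h3 hC0
    have h5 := abs_sub_le (h x) (h 0) (h (powerFlow r t x))
    rw [abs_sub_comm (h 0)] at h5
    linarith
  refine (iInf₂_le _ hwd).trans (add_le_add ?_ ((eLpNorm_add_le ?_ ?_ hp1).trans
    (add_le_add ?_ ?_)))
  · refine (eLpNorm_le_of_ae_bound (C := Real.exp (h 0 * t + C) *
      (|c| + ∫ y in (0 : ℝ)..powerFlow r t 1, |v y|)) ?_).trans (by rw [hone]; simp)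
    filter_upwards [ae_comp_powerFlow hr ht hf, ae_restrict_mem measurableSet_Ioo] with x hx hxm
    rw [vonFoersterLasota_apply hr ht hxm hh, hx, norm_mul,
      Real.norm_of_nonneg (Real.exp_nonneg _)]
    exact mul_le_mul (hE x hxm) (hG x hxm) (norm_nonneg _) (Real.exp_nonneg _)
  · refine ContinuousOn.aestronglyMeasurable ?_ measurableSet_Ioo
    have hφc : ContinuousOn (powerFlow r t) (Ioo 0 1) := fun x hx =>
      (hasDerivAt_powerFlow hr ht hx.1).continuousAt.continuousWithinAt
    refine ContinuousOn.mul (ContinuousOn.mul (fun x hx =>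
      (hasDerivAt_weight hr hh ht hx).continuousAt.continuousWithinAt) ?_) ?_
    · exact (hh.sub (hh.comp hφc fun x hx => powerFlow_mem hr ht hx)).div
        (continuousOn_id.rpow_const fun y hy => Or.inl hy.1.ne')
        fun y hy => (Real.rpow_pos_of_pos hy.1 r).ne'
    · exact (continuousOn_primitive_Icc one_pos hvi c).comp hφc
        fun x hx => Ioo_subset_Icc_self (powerFlow_mem hr ht hx)
  · refine AEStronglyMeasurable.mul (ContinuousOn.aestronglyMeasurable (fun x hx =>
      (hasDerivAt_weight hr hh ht hx).continuousAt.continuousWithinAt) measurableSet_Ioo)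
      hw.aestronglyMeasurable
  · refine (eLpNorm_le_of_ae_bound (C := 2 * C * (Real.exp (h 0 * t + C) *
      (|c| + ∫ y in (0 : ℝ)..powerFlow r t 1, |v y|))) ?_).trans (by rw [hone]; simp)
    filter_upwards [ae_restrict_mem measurableSet_Ioo] with x hxm
    rw [norm_mul, norm_mul, Real.norm_of_nonneg (Real.exp_nonneg _), ← mul_assoc,
      mul_comm (2 * C)]
    exact mul_le_mul (mul_le_mul (hE x hxm) (hq x hxm) (norm_nonneg _) (Real.exp_nonneg _))
      (hG x hxm) (norm_nonneg _) (by positivity)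
  · rw [← eLpNorm_powerFlow hp hr ht]
    refine eLpNorm_le_mul_eLpNorm_of_ae_le_mul ?_ _
    filter_upwards [ae_restrict_mem measurableSet_Ioo] with x hx
    have hd : 0 < powerFlow r t x / x := div_pos (powerFlow_pos hr ht hx.1) hx.1
    have hd1 : powerFlow r t x / x ≤ 1 := (div_le_one hx.1).2 (powerFlow_le_self hr ht hx.1)
    rw [norm_mul, norm_mul, norm_mul, Real.norm_of_nonneg (Real.exp_nonneg _),
      Real.norm_of_nonneg (Real.rpow_nonneg hd.le _),
      Real.norm_of_nonneg (Real.rpow_nonneg hd.le _)]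
    refine mul_le_mul ((hE x hx).trans ?_) ?_ (by positivity) (Real.exp_nonneg _)
    · rw [Real.exp_le_exp]
      linarith [mul_nonpos_of_nonpos_of_nonneg h0 ht]
    · refine mul_le_mul_of_nonneg_right ?_ (norm_nonneg _)
      exact Real.rpow_le_rpow_of_exponent_ge hd hd1 (div_le_self (by linarith) hp)

/-- The integral of `|v|` up to `φ_t(1)` vanishes in the limit, so only `exp(h(0)t)|c|` can survive.
It dies either by exponential decay or because `c = 0`. -/
theorem tendsto_sobolevNorm_vonFoersterLasota (hp : 1 ≤ p) (hr : 1 < r) {h : ℝ → ℝ} {C : ℝ}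
    (hh : ContinuousOn h (Ioo 0 1)) (hC0 : 0 ≤ C)
    (hC : ∀ x ∈ Ioo (0 : ℝ) 1, |(h x - h 0) / x ^ r| ≤ C) (h0 : h 0 ≤ 0)
    {f v : ℝ → ℝ} {c : ℝ} (hv : MemLp v (ENNReal.ofReal p) (volIoo 0 1))
    (hf : ∀ᵐ x ∂(volIoo 0 1), f x = c + ∫ y in (0 : ℝ)..x, v y) (hc : h 0 < 0 ∨ c = 0) :
    Tendsto (fun t => sobolevNorm 0 1 (ENNReal.ofReal p) (vonFoersterLasota r h t f))
      atTop (𝓝 0) := by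
  have hvi := integrableOn_of_memLp hp hv
  have hι : Tendsto (fun t => |c| + ∫ y in (0 : ℝ)..powerFlow r t 1, |v y|) atTop (𝓝 |c|) := by
    have h1 := (continuousOn_primitive_Icc one_pos hvi.abs |c|) 0 (left_mem_Icc.2 zero_le_one)
    have h2 : Tendsto (fun t => powerFlow r t 1) atTop (𝓝[Icc 0 1] 0) :=
      tendsto_nhdsWithin_iff.2 ⟨tendsto_powerFlow hr 1, by
        filter_upwards [eventually_ge_atTop 0] with t ht
        exact ⟨(powerFlow_pos hr ht one_pos).le, powerFlow_le_self hr ht one_pos⟩⟩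
    have h3 := h1.tendsto.comp h2
    simpa [Function.comp_def] using h3
  have hm : Tendsto (fun t => Real.exp (h 0 * t + C) *
      (|c| + ∫ y in (0 : ℝ)..powerFlow r t 1, |v y|)) atTop (𝓝 0) := by
    rcases hc with hc | rfl
    · have h1 : Tendsto (fun t => Real.exp (h 0 * t + C)) atTop (𝓝 0) :=
        Real.tendsto_exp_atBot.comp
          (tendsto_atBot_add_const_right _ _ (tendsto_id.const_mul_atTop_of_neg hc))
      simpa using h1.mul hι
    · rw [abs_zero] at hι
      have h1 : Tendsto (fun t => Real.exp C *
          (|(0 : ℝ)| + ∫ y in (0 : ℝ)..powerFlow r t 1, |v y|)) atTop (𝓝 0) := by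
        simpa using hι.const_mul (Real.exp C)
      refine squeeze_zero' ?_ ?_ h1
      · filter_upwards [eventually_ge_atTop 0] with t ht
        exact mul_nonneg (Real.exp_nonneg _) (add_nonneg (abs_nonneg _)
          (intervalIntegral.integral_nonneg (powerFlow_pos hr ht one_pos).le
            fun y _ => abs_nonneg _))
      · filter_upwards [eventually_ge_atTop 0] with t ht
        refine mul_le_mul_of_nonneg_right ?_ (add_nonneg (abs_nonneg _)
          (intervalIntegral.integral_nonneg (powerFlow_pos hr ht one_pos).le
            fun y _ => abs_nonneg _))
        rw [Real.exp_le_exp]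
        linarith [mul_nonpos_of_nonpos_of_nonneg h0 ht]
  have l1 := ENNReal.tendsto_ofReal hm
  have l2 := ENNReal.tendsto_ofReal (hm.const_mul (2 * C))
  have l3 := ENNReal.Tendsto.const_mul (a := ENNReal.ofReal (Real.exp C))
    (tendsto_eLpNorm_Ioo_powerFlow hp hr hv) (Or.inr ENNReal.ofReal_ne_top)
  have lim := l1.add (l2.add l3)
  simp only [mul_zero, ENNReal.ofReal_zero, add_zero] at lim
  refine tendsto_of_tendsto_of_tendsto_of_le_of_le' tendsto_const_nhds lim
    (Eventually.of_forall fun _ => bot_le) ?_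
  filter_upwards [eventually_ge_atTop 0] with t ht
  exact sobolevNorm_vonFoersterLasota_le hp hr hh hC0 hC h0 ht hv hf

/-- Functions that stay away from zero on `(1/2, 1)` do not tend to zero. -/
theorem not_tendsto_sobolevNorm (hp : 1 ≤ p) {u : ℝ → ℝ → ℝ} {δ : ℝ} (hδ : 0 < δ)
    (hu : ∀ᶠ t in atTop, ∀ x ∈ Ioo (1 / 2 : ℝ) 1, δ ≤ |u t x|) :
    ¬ Tendsto (fun t => sobolevNorm 0 1 (ENNReal.ofReal p) (u t)) atTop (𝓝 0) := by
  intro hlim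
  have hp0 : ENNReal.ofReal p ≠ 0 := by
    simp only [ne_eq, ENNReal.ofReal_eq_zero, not_le]; linarith
  have hvol : volIoo (1 / 2) 1 univ ≠ 0 := by
    rw [Measure.restrict_apply_univ, Real.volume_Ioo]
    simp only [ne_eq, ENNReal.ofReal_eq_zero, not_le]
    norm_num
  have hlow : ∀ᶠ t in atTop, eLpNorm (fun _ : ℝ => δ) (ENNReal.ofReal p) (volIoo (1 / 2) 1)
      ≤ sobolevNorm 0 1 (ENNReal.ofReal p) (u t) := by
    filter_upwards [hu] with t ht
    -- The `L^p` part alone bounds every competitor in the infimum from below, so the weak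
    -- derivative plays no role.
    refine le_iInf₂ fun v _ => le_trans ?_ le_self_add
    calc _ ≤ eLpNorm (u t) (ENNReal.ofReal p) (volIoo (1 / 2) 1) := by
          refine eLpNorm_mono_ae ?_
          filter_upwards [ae_restrict_mem measurableSet_Ioo] with x hx
          rw [Real.norm_of_nonneg hδ.le]
          exact ht x hx
      _ ≤ _ := eLpNorm_mono_measure _
          (Measure.restrict_mono (Ioo_subset_Ioo_left (by norm_num)) le_rfl)
  have h0 := ge_of_tendsto hlim hlow
  rw [nonpos_iff_eq_zero, eLpNorm_const _ hp0 (fun h => hvol (by rw [h]; rfl))] at h0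
  rw [mul_eq_zero, ENNReal.rpow_eq_zero_iff] at h0
  rcases h0 with h0 | h0 | h0
  · exact hδ.ne' (by simpa using h0)
  · exact hvol h0.1
  · exact measure_ne_top _ _ h0.1

/-- The flow decays only like `t^(-1/(r-1))`. In the variable `s = (r-1)t + x^(1-r)` the product is
a positive constant times `exp(b s/(r-1)) / s^(1/(r-1))`. -/
theorem tendsto_exp_mul_powerFlow (hr : 1 < r) {b : ℝ} (hb : 0 < b) (x : ℝ) :
    Tendsto (fun t => Real.exp (b * t) * powerFlow r t x) atTop atTop := by
  have hr1 : 0 < r - 1 := by linarith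
  have h1 : Tendsto (fun t : ℝ => (r - 1) * t + x ^ (1 - r)) atTop atTop :=
    tendsto_atTop_add_const_right _ _ (tendsto_id.const_mul_atTop hr1)
  have h2 := ((tendsto_exp_mul_div_rpow_atTop (1 / (r - 1)) (b / (r - 1))
    (div_pos hb hr1)).comp h1).const_mul_atTop
      (Real.exp_pos (-(b / (r - 1) * x ^ (1 - r))))
  refine h2.congr' ?_
  filter_upwards [h1.eventually_gt_atTop 0] with t ht
  simp only [Function.comp]
  have e : 1 / (1 - r) = -(1 / (r - 1)) := by rw [← one_div_neg_eq_neg_one_div, neg_sub]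
  rw [powerFlow, e, Real.rpow_neg ht.le, ← mul_div_assoc, ← Real.exp_add, div_eq_mul_inv]
  congr 2
  field_simp
  ring

theorem one_mem_sobolevSpace (q : ℝ≥0∞) : (fun _ => 1) ∈ sobolevSpace 0 1 q := by
  refine ⟨memLp_const 1, fun _ => 0, ?_, memLp_const 0⟩
  exact hasWeakDeriv_mul_primitive one_pos (w := fun _ => 0) integrableOn_zero 1
    (E := fun _ => 1) (E' := fun _ => 0) (fun x _ => hasDerivAt_const x 1) continuousOn_const
    (Eventually.of_forall fun x => by simp) (Eventually.of_forall fun x => by simp)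

theorem id_mem_sobolevSpaceStar (q : ℝ≥0∞) : (fun x => x) ∈ sobolevSpaceStar 0 1 q := by
  refine ⟨⟨?_, fun _ => 1, ?_, memLp_const 1⟩, fun x => x, continuousOn_id, ae_eq_refl _, rfl⟩
  · refine MemLp.of_bound measurable_id.aestronglyMeasurable 1 ?_
    filter_upwards [ae_restrict_mem measurableSet_Ioo] with x hx
    rw [Real.norm_of_nonneg hx.1.le]
    exact hx.2.le
  · exact hasWeakDeriv_mul_primitive one_pos (w := fun _ => 1)
      (integrableOn_const (by simp)) 0
      (E := fun _ => 1) (E' := fun _ => 0) (fun x _ => hasDerivAt_const x 1) continuousOn_const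
      (Eventually.of_forall fun x => by simp) (Eventually.of_forall fun x => by simp)

section Stability

variable {h : ℝ → ℝ} {C : ℝ}

theorem isStableOn_sobolevSpace_iff (hp : 1 ≤ p) (hr : 1 < r)
    (hh : ContinuousOn h (Ioo 0 1)) (hC0 : 0 ≤ C)
    (hC : ∀ x ∈ Ioo (0 : ℝ) 1, |(h x - h 0) / x ^ r| ≤ C) :
    IsStableOn (vonFoersterLasota r h) (sobolevSpace 0 1 (ENNReal.ofReal p))
      (sobolevNorm 0 1 (ENNReal.ofReal p)) ↔ h 0 < 0 := by
  constructor
  · intro hst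
    by_contra! h0
    -- The orbit of the constant `1` is the weight itself, at least `exp(-C)` when `h(0) ≥ 0`.
    refine not_tendsto_sobolevNorm hp (Real.exp_pos (-C)) ?_ (hst _ (one_mem_sobolevSpace _))
    filter_upwards [eventually_ge_atTop 0] with t ht x hx
    have hx' : x ∈ Ioo (0 : ℝ) 1 := ⟨lt_trans (by norm_num) hx.1, hx.2⟩
    rw [vonFoersterLasota_apply hr ht hx' hh, mul_one, abs_of_pos (Real.exp_pos _),
      Real.exp_le_exp]
    linarith [(abs_le.1 (abs_integral_sub_le hr hh hC0 hC ht hx')).1, mul_nonneg h0 ht]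
  · rintro h0 f ⟨-, v, hfv, hv⟩
    obtain ⟨c, hc⟩ := hfv.exists_ae_eq_primitive one_pos (integrableOn_of_memLp hp hv)
    exact tendsto_sobolevNorm_vonFoersterLasota hp hr hh hC0 hC h0.le hv hc (Or.inl h0)

theorem isStableOn_sobolevSpaceStar_iff (hp : 1 ≤ p) (hr : 1 < r)
    (hh : ContinuousOn h (Ioo 0 1)) (hC0 : 0 ≤ C)
    (hC : ∀ x ∈ Ioo (0 : ℝ) 1, |(h x - h 0) / x ^ r| ≤ C) :
    IsStableOn (vonFoersterLasota r h) (sobolevSpaceStar 0 1 (ENNReal.ofReal p))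
      (sobolevNorm 0 1 (ENNReal.ofReal p)) ↔ h 0 ≤ 0 := by
  constructor
  · intro hst
    by_contra! h0
    -- The orbit of `x` is `E_t φ_t`; for `h(0) > 0` the exponential growth of the weight outruns
    -- the decay of the flow.
    refine not_tendsto_sobolevNorm hp (Real.exp_pos (-C)) ?_ (hst _ (id_mem_sobolevSpaceStar _))
    filter_upwards [eventually_ge_atTop 0,
      (tendsto_exp_mul_powerFlow hr h0 (1 / 2)).eventually_ge_atTop 1] with t ht ht1 x hx
    have hx' : x ∈ Ioo (0 : ℝ) 1 := ⟨lt_trans (by norm_num) hx.1, hx.2⟩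
    have hφ := powerFlow_pos hr ht hx'.1
    rw [vonFoersterLasota_apply hr ht hx' hh, abs_of_pos (mul_pos (Real.exp_pos _) hφ)]
    calc Real.exp (-C) ≤ Real.exp (-C) * (Real.exp (h 0 * t) * powerFlow r t (1 / 2)) :=
          le_mul_of_one_le_right (Real.exp_nonneg _) ht1
      _ = Real.exp (-C + h 0 * t) * powerFlow r t (1 / 2) := by rw [Real.exp_add, mul_assoc]
      _ ≤ _ := by
          refine mul_le_mul ?_ ?_ (powerFlow_pos hr ht (by norm_num)).le (Real.exp_nonneg _)
          · rw [Real.exp_le_exp]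
            linarith [(abs_le.1 (abs_integral_sub_le hr hh hC0 hC ht hx')).1]
          · exact (powerFlow_strictMonoOn hr ht (mem_Ioi.2 (by norm_num)) hx'.1 hx.1).le
  · rintro h0 f ⟨⟨-, v, hfv, hv⟩, w, hwc, hfw, hw0⟩
    have hvi := integrableOn_of_memLp hp hv
    obtain ⟨c, hc⟩ := hfv.exists_ae_eq_primitive one_pos hvi
    -- Two continuous representatives agree up to the endpoint, so the constant `c` is the boundary
    -- value `w 0`.
    have heq : EqOn w (fun x => c + ∫ y in (0 : ℝ)..x, v y) (Icc 0 1) := by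
      refine Measure.eqOn_Icc_of_ae_eq (μ := volume) zero_ne_one ?_ hwc
        (continuousOn_primitive_Icc one_pos hvi c)
      rw [← restrict_Ioo_eq_restrict_Icc]
      exact hfw.symm.trans hc
    have hc0 : c = 0 := by
      have := heq (left_mem_Icc.2 zero_le_one)
      simp only [intervalIntegral.integral_same, add_zero] at this
      rw [← this, hw0]
    exact tendsto_sobolevNorm_vonFoersterLasota hp hr hh hC0 hC h0 hv hc (Or.inr hc0)

end Stability

end

theorem theorem6 (p r : ℝ) (hp : 1 ≤ p) (hr : 1 < r) (h : ℝ → ℝ)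
    (hh : ContinuousOn h (Set.Icc 0 1)) :
    (MemLp (fun x => (h x - x ^ (r - 1) * h 0) / x ^ r) 1 (volIoo 0 1) →
      (IsStableOn (vonFoersterLasota r h)
          (lebesgueSpace 0 1 (ENNReal.ofReal p)) (lebesgueNorm 0 1 (ENNReal.ofReal p)) ↔
        h 0 ≤ -r / p)) ∧
    (h ∈ sobolevSpace 0 1 ∞ →
      MemLp (fun x => (h x - h 0) / x ^ r) ∞ (volIoo 0 1) →
      (IsStableOn (vonFoersterLasota r h)
          (sobolevSpaceStar 0 1 (ENNReal.ofReal p)) (sobolevNorm 0 1 (ENNReal.ofReal p)) ↔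
        h 0 ≤ 0) ∧
      (IsStableOn (vonFoersterLasota r h)
          (sobolevSpace 0 1 (ENNReal.ofReal p)) (sobolevNorm 0 1 (ENNReal.ofReal p)) ↔
        h 0 < 0)) := by
  have hho : ContinuousOn h (Ioo 0 1) := hh.mono Ioo_subset_Icc_self
  refine ⟨fun hg => ?_, fun _ hb => ?_⟩
  · have hgi := memLp_one_iff_integrable.1 hg
    exact ⟨le_of_isStableOn_lebesgueSpace hp hr hho hgi,
      isStableOn_lebesgueSpace hp hr hho hgi⟩
  · have hk : ContinuousOn (fun x => (h x - h 0) / x ^ r) (Ioo 0 1) :=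
      (hho.sub continuousOn_const).div
        (continuousOn_id.rpow_const fun y hy => Or.inl hy.1.ne')
        fun y hy => (Real.rpow_pos_of_pos hy.1 r).ne'
    obtain ⟨C, hC0, hC⟩ := exists_forall_norm_le_of_memLp_top hk hb
    exact ⟨isStableOn_sobolevSpaceStar_iff hp hr hho hC0 hC,
      isStableOn_sobolevSpace_iff hp hr hho hC0 hC⟩
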